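/- Work in Cantor space $2^\omega$ with the fair-coin measure $\mu$; sets of natural numbers are identified with elements of $2^\omega$. The basic open sets are the cylinders $[\sigma]=\{X\in 2^\omega : X \succ \sigma\}$, $\sigma\in 2^{<\omega}$, and $\varnothing$; a code for an open set $U$ is a sequence $\langle C_s\rangle_{s\in\mathbb{N}}$ of basic open sets with $U=\bigcup_s C_s$. A function $f\in\mathbb{N}^{\mathbb{N}}$ encodes a Schnorr test $\langle U_n\rangle_{n\in\mathbb N}$ if it encodes, for each $n$, a code for the open set $U_n$ and a sequence of rationals $\langle q_s\rangle$ converging to $\mu(U_n)$ with $|q_m-q_k|\le 2^{-k}$ for all $m\ge k$, where $\mu(U_n)\le 2^{-n}$ for all $n$. A function is truth-table reducible to $B\in 2^\omega$ if it equals $\Phi(B)$ for some total computable functional $\Phi\colon 2^\omega\to\mathbb{N}^{\mathbb{N}}$. For $A,B\in 2^\omega$: (i) $A$ is Schnorr random relative to $B$ if there is no Schnorr test $\langle U_n\rangle$ encoded by a function computable from $B$ with $A\in\bigcap_n U_n$. (ii) $A$ is Schnorr random uniformly relative to $B$ if there is no total computable functional $\Phi\colon 2^\omega\to\mathbb{N}^{\mathbb{N}}$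 such that $\Phi(X)$ encodes a Schnorr test $\langle U^X_n\rangle$ for every $X\in 2^\omega$ and $A\in\bigcap_n U^B_n$. (iii) $A$ is truth-table (test) Schnorr random relative to $B$ if there is no sequence $\langle U_n\rangle$ of open sets, with codes uniformly truth-table reducible to $B$, such that $\mu(U_n)=2^{-n}$ and $A\in U_n$ for all $n$. Proposition. For all $A,B\in 2^\omega$, $A$ is truth-table (test) Schnorr random relative to $B$ if and only if $A$ is Schnorr random relative to $B$. Moreover, there exist $A,B\in 2^\omega$ such that $A$ is Schnorr random uniformly relative to $B$ but not truth-table (test) Schnorr random relative to $B$. -/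

import Mathlib

namespace SchnorrRel

open MeasureTheory Filter Topology
open scoped ENNReal

/-- Cantor space `2^ω`; a set of natural numbers is identified with its characteristic sequence. -/
abbrev Cantor : Type := ℕ → Bool

/-- The fair-coin measure on Cantor space. -/
noncomputable def fairCoin : Measure Cantor :=
  Measure.infinitePi fun _ : ℕ => (PMF.uniformOfFintype Bool).toMeasure

/-- The initial segment of `X` of length `k`. -/
def initSeg (X : Cantor) (k : ℕ) : List Bool := (List.range k).map X

/-- Basic open sets: `some σ` names the cylinder `[σ]` of all `X` extending `σ`,
and `none` names the empty set. -/
def basicOpen : Option (List Bool) → Set Cantor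
  | none => ∅
  | some σ => {X | initSeg X σ.length = σ}

/-- The open set coded by a sequence of (names of) basic open sets. -/
def openOfCode (C : ℕ → Option (List Bool)) : Set Cantor := ⋃ s, basicOpen (C s)

/-- Triples of natural numbers name rationals; every rational has a name. -/
def ratOfCode (p : ℕ × ℕ × ℕ) : ℚ := ((p.1 : ℚ) - p.2.1) / (p.2.2 + 1)

/-- A sequence of rationals is fast-Cauchy if `|q m - q k| ≤ 2 ^ (-k)` whenever `k ≤ m`. -/
def FastCauchy (q : ℕ → ℚ) : Prop := ∀ k m : ℕ, k ≤ m → |q m - q k| ≤ (1 / 2) ^ k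

/-- The oracle given by the characteristic function of `B`. -/
def oracle (B : Cantor) : Set (ℕ →. ℕ) := {fun n => Part.some (B n).toNat}

/-- `Φ`, sending each oracle `X` to a total function `Φ X : α → σ`, is a total computable
functional: some computable `φ` returns, on a long enough initial segment of `X`, the value
`Φ X a`, and on every initial segment of `X` returns either this value or no answer (`none`). -/
def TotalComputableFunctional {α σ : Type} [Primcodable α] [Primcodable σ]
    (Φ : Cantor → α → σ) : Prop :=
  ∃ φ : List Bool → α → Option σ, Computable₂ φ ∧
    ∀ (X : Cantor) (a : α),
      (∃ k, φ (initSeg X k) a = some (Φ X a)) ∧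
      ∀ k v, φ (initSeg X k) a = some v → v = Φ X a

/-- `f` is truth-table reducible to `B`: it is the value at `B` of a total computable functional. -/
def TTReducible {α σ : Type} [Primcodable α] [Primcodable σ] (f : α → σ) (B : Cantor) : Prop :=
  ∃ Φ : Cantor → α → σ, TotalComputableFunctional Φ ∧ Φ B = f

/-- A function that may code a Schnorr test: the value at `(n, s)` consists of (the name of) the
`s`-th basic open set in the listing of `U n`, and (the name of) the `s`-th rational
approximation of the measure of `U n`. -/
abbrev TestCode : Type := ℕ × ℕ → Option (List Bool) × (ℕ × ℕ × ℕ)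

/-- The `n`-th open set `U n` listed by `c`. -/
def TestCode.level (c : TestCode) (n : ℕ) : Set Cantor := openOfCode fun s => (c (n, s)).1

/-- The sequence of rationals that `c` provides for the measure of `U n`. -/
def TestCode.approx (c : TestCode) (n s : ℕ) : ℚ := ratOfCode (c (n, s)).2

/-- `c` encodes a Schnorr test: `μ (U n) ≤ 2 ^ (-n)`, and the rationals provided for `U n` form
a fast-Cauchy sequence converging to `μ (U n)`. -/
def IsSchnorrTest (c : TestCode) : Prop :=
  ∀ n, fairCoin (c.level n) ≤ (2⁻¹ : ℝ≥0∞) ^ n ∧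
    FastCauchy (c.approx n) ∧
    Tendsto (fun s => (c.approx n s : ℝ)) atTop (𝓝 (fairCoin (c.level n)).toReal)

/-- `A` is Schnorr random relative to `B`: no Schnorr test computable from `B` covers `A`. -/
def SchnorrRandomRelativeTo (A B : Cantor) : Prop :=
  ¬ ∃ c : TestCode, ComputableIn (oracle B) c ∧ IsSchnorrTest c ∧ ∀ n, A ∈ c.level n

/-- A uniform Schnorr test: a total computable map all of whose values encode Schnorr tests. -/
def IsUniformSchnorrTest (Φ : Cantor → TestCode) : Prop :=
  TotalComputableFunctional Φ ∧ ∀ X, IsSchnorrTest (Φ X)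

/-- `A` is Schnorr random uniformly relative to `B`. -/
def SchnorrRandomUniformlyRelativeTo (A B : Cantor) : Prop :=
  ¬ ∃ Φ : Cantor → TestCode, IsUniformSchnorrTest Φ ∧ ∀ n, A ∈ (Φ B).level n

/-- `A` is "truth-table (test) Schnorr random" relative to `B`: there is no sequence `U n` of open
sets, with codes uniformly truth-table reducible to `B`, such that `μ (U n) = 2 ^ (-n)` and
`A ∈ U n` for all `n`. -/
def TTTestSchnorrRandomRelativeTo (A B : Cantor) : Prop :=
  ¬ ∃ C : ℕ × ℕ → Option (List Bool), TTReducible C B ∧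
    (∀ n, fairCoin (openOfCode fun s => C (n, s)) = (2⁻¹ : ℝ≥0∞) ^ n) ∧
    ∀ n, A ∈ openOfCode fun s => C (n, s)

end SchnorrRel

namespace SchnorrRel

open MeasureTheory Filter Topology
open scoped ENNReal

/-! ### Cylinders and their measure -/

/-! Equivalence. A test of measure exactly `2 ^ (-n)` is a Schnorr test with constant
approximations, and truth-table reducibility implies computability in `B`. For the converse, a code
may list the empty set at will. An index `W` therefore carries its own bound on computation time and
oracle use: if the computation of the given test from `B` halts within these bounds its output is
listed, otherwise `∅` is. This is total on every oracle, hence truth-table (`exists_stage_approx`,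
`exists_tt_fill`). To raise the measure of `U` to exactly `2 ^ (-n)`, one adds every initial
interval `I` of the lexicographic order with `μ (U ∪ I) < 2 ^ (-n)`. This condition is recognised in
finite time, since `μ (U ∪ I) = μ (U) + μ (I \ U)`, where the first term is approximated by the
given rationals and the second from above by finite parts of `U`. The intervals form a chain with
arbitrarily small increments, so the union has the required measure (`fairCoin_fill`,
`openOfCode_fill`).

Separation. Since a uniform test supplies correct measures for every oracle, its levels vary upper
semicontinuously in measure (`IsUniformSchnorrTest.upperSemicont`). A finite extension argument
builds `A` and `B`. At stage `s` a small level of the `s`-th uniform test is added to the set `A`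
must avoid, and `A` is extended by `s` zeros at some position `m` while positive measure remains
available (`exists_zero_block`). By semicontinuity this survives for all oracles in a small enough
cylinder, and only beyond its length does `B` reveal `m` (`Stage.exists_extends`). Uniform tests
thus cannot exploit the revealed positions, whereas a truth-table test, whose measures need be
correct at `B` alone, reads them off and captures `A` (`not_ttTest_of_blocks`). -/

/-- The sequences that agree with `X` below `k`. -/
def cyl (X : Cantor) (k : ℕ) : Set Cantor := {Y | ∀ i < k, Y i = X i}

instance : IsProbabilityMeasure fairCoin := by
  unfold fairCoin; infer_instance

theorem mem_cyl_self (X : Cantor) (k : ℕ) : X ∈ cyl X k := fun _ _ => rfl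

theorem cyl_anti (X : Cantor) {k l : ℕ} (h : k ≤ l) : cyl X l ⊆ cyl X k :=
  fun _ hY i hi => hY i (hi.trans_le h)

theorem cyl_eq_of_mem {X Y : Cantor} {k : ℕ} (h : Y ∈ cyl X k) : cyl Y k = cyl X k := by
  ext Z
  exact ⟨fun hZ i hi => (hZ i hi).trans (h i hi), fun hZ i hi => (hZ i hi).trans (h i hi).symm⟩

theorem initSeg_length (X : Cantor) (k : ℕ) : (initSeg X k).length = k := by
  simp [initSeg]

theorem initSeg_succ (X : Cantor) (k : ℕ) : initSeg X (k + 1) = initSeg X k ++ [X k] := by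
  simp [initSeg, List.range_succ]

theorem initSeg_getElem? (X : Cantor) {k i : ℕ} (h : i < k) : (initSeg X k)[i]? = some (X i) := by
  simp [initSeg, h]

theorem initSeg_eq_iff {X Y : Cantor} {k : ℕ} : initSeg Y k = initSeg X k ↔ Y ∈ cyl X k := by
  simp [initSeg, cyl]

theorem exists_initSeg_eq (σ : List Bool) : ∃ X : Cantor, initSeg X σ.length = σ := by
  refine ⟨fun i => σ.getD i false, ?_⟩
  apply List.ext_getElem
  · simp [initSeg]
  · intro i h1 h2
    simp [initSeg, h2]

/-- A nonempty basic open set is a cylinder. -/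
theorem basicOpen_some_eq_cyl (σ : List Bool) : ∃ X : Cantor, basicOpen (some σ) = cyl X σ.length := by
  obtain ⟨X, hX⟩ := exists_initSeg_eq σ
  refine ⟨X, ?_⟩
  ext Y
  change initSeg Y σ.length = σ ↔ _
  rw [← initSeg_eq_iff, hX]

theorem measurableSet_cyl (X : Cantor) (k : ℕ) : MeasurableSet (cyl X k) := by
  have : cyl X k = ⋂ i, ⋂ (_ : i < k), (fun Y : Cantor => Y i) ⁻¹' {X i} := by
    ext Y; simp [cyl]
  rw [this]
  exact MeasurableSet.iInter fun i => MeasurableSet.iInter fun _ =>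
    (measurable_pi_apply i) (measurableSet_singleton _)

theorem measurableSet_basicOpen (o : Option (List Bool)) : MeasurableSet (basicOpen o) := by
  cases o with
  | none => exact MeasurableSet.empty
  | some σ =>
    obtain ⟨X, hX⟩ := basicOpen_some_eq_cyl σ
    rw [hX]; exact measurableSet_cyl _ _

theorem measurableSet_openOfCode (C : ℕ → Option (List Bool)) : MeasurableSet (openOfCode C) :=
  MeasurableSet.iUnion fun _ => measurableSet_basicOpen _

theorem fairCoin_box (s : Finset ℕ) (X : Cantor) :
    fairCoin {Y | ∀ i ∈ s, Y i = X i} = (2⁻¹ : ℝ≥0∞) ^ s.card := by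
  have h : {Y : Cantor | ∀ i ∈ s, Y i = X i} = Set.pi (s : Set ℕ) fun i => {X i} := by
    ext Y; simp [Set.mem_pi]
  rw [h, fairCoin, Measure.infinitePi_pi _ (fun i _ => measurableSet_singleton _)]
  simp

theorem fairCoin_cyl (X : Cantor) (k : ℕ) : fairCoin (cyl X k) = (2⁻¹ : ℝ≥0∞) ^ k := by
  have := fairCoin_box (Finset.range k) X
  simpa [cyl] using this

theorem fairCoin_real_cyl (X : Cantor) (k : ℕ) : fairCoin.real (cyl X k) = (1 / 2 : ℝ) ^ k := by
  simp [Measure.real, fairCoin_cyl]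

theorem exists_cyl_subset_of_mem_openOfCode {C : ℕ → Option (List Bool)} {A : Cantor}
    (h : A ∈ openOfCode C) : ∃ l, cyl A l ⊆ openOfCode C := by
  obtain ⟨s, hs⟩ := Set.mem_iUnion.1 h
  cases hC : C s with
  | none => rw [hC] at hs; exact hs.elim
  | some σ =>
    obtain ⟨X, hX⟩ := basicOpen_some_eq_cyl σ
    rw [hC, hX] at hs
    refine ⟨σ.length, ?_⟩
    rw [cyl_eq_of_mem hs, ← hX, ← hC]
    exact Set.subset_iUnion (fun s => basicOpen (C s)) s

/-! ### Oracle computations -/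

/-- A functional that evaluates a computable function at an initial segment of the oracle of
computable length is total computable. -/
theorem totalComputableFunctional_of_use {α σ : Type} [Primcodable α] [Primcodable σ]
    {F : List Bool → α → σ} {κ : α → ℕ} (hF : Computable₂ F) (hκ : Computable κ) :
    TotalComputableFunctional fun X a => F (initSeg X (κ a)) a := by
  refine ⟨fun τ a => bif (τ.length == κ a) then some (F τ a) else none, ?_, fun X a => ⟨⟨κ a, ?_⟩, ?_⟩⟩
  · refine Computable.cond ?_ ?_ (Computable.const none)
    · exact (Primrec.beq.to_comp).comp (Computable.list_length.comp Computable.fst)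
        (hκ.comp Computable.snd)
    · exact Computable.option_some.comp hF
  · simp [initSeg_length]
  · intro k v h
    by_cases hk : k = κ a
    · subst hk; simpa [initSeg_length, eq_comm] using h
    · simp [initSeg_length, beq_false_of_ne hk] at h

theorem recursiveIn_initSeg (B : Cantor) :
    Nat.RecursiveIn (oracle B) fun n => Part.some (Encodable.encode (initSeg B n)) := by
  -- Appends the bit in the second component to the string coded by the first. The default `[]` is
  -- never reached, because the recursion only meets codes of strings.
  let step : ℕ → ℕ := fun p =>
    Encodable.encode (((Encodable.decode (α := List Bool) p.unpair.1).getD []) ++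
      [decide (p.unpair.2 = 1)])
  have hstep : Primrec step := by
    refine Primrec.encode.comp (Primrec.list_append.comp ?_ ?_)
    · exact Primrec.option_getD.comp (Primrec.decode.comp (Primrec.fst.comp Primrec.unpair))
        (Primrec.const [])
    · refine Primrec.list_cons.comp ?_ (Primrec.const [])
      exact (Primrec.eq.comp (Primrec.snd.comp Primrec.unpair) (Primrec.const 1)).decide
  have h1 : Nat.RecursiveIn (oracle B) fun n => Part.some (step n) :=
    Nat.Primrec.recursiveIn (Primrec.nat_iff.1 hstep)
  have hor : Nat.RecursiveIn (oracle B) fun n => Part.some (B n).toNat :=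
    Nat.RecursiveIn.oracle _ rfl
  have hy : Nat.RecursiveIn (oracle B) fun n => Part.some (n.unpair.2.unpair.1) :=
    Nat.Primrec.recursiveIn (Primrec.nat_iff.1 (Primrec.fst.comp (Primrec.unpair.comp
      (Primrec.snd.comp Primrec.unpair))))
  have hi : Nat.RecursiveIn (oracle B) fun n => Part.some (n.unpair.2.unpair.2) :=
    Nat.Primrec.recursiveIn (Primrec.nat_iff.1 (Primrec.snd.comp (Primrec.unpair.comp
      (Primrec.snd.comp Primrec.unpair))))
  have hnil : Nat.RecursiveIn (oracle B) fun _ => Part.some (Encodable.encode ([] : List Bool)) :=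
    Nat.Primrec.recursiveIn (Primrec.nat_iff.1 (Primrec.const _))
  have hpair : Nat.RecursiveIn (oracle B) fun n => Part.some (Nat.pair 0 n) :=
    Nat.Primrec.recursiveIn (Primrec.nat_iff.1 (Primrec₂.natPair.comp (Primrec.const 0) Primrec.id))
  have h2 := h1.comp (hi.pair (hor.comp hy))
  refine ((hnil.prec h2).comp hpair).of_eq fun n => ?_
  simp only [Part.bind_eq_bind, Part.bind_some, Nat.unpair_pair]
  induction n with
  | zero => simp [initSeg]
  | succ n ih =>
    simp only [ih, Part.bind_some]
    simp [Seq.seq, step, initSeg_succ]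

/-- Search for a segment of `B` on which `φ` answers. The search ends, and all answers agree, so
whichever is found first is correct. -/
theorem TTReducible.computableIn {α σ : Type} [Primcodable α] [Primcodable σ] {f : α → σ}
    {B : Cantor} (h : TTReducible f B) : ComputableIn (oracle B) f := by
  obtain ⟨Φ, ⟨φ, hφ, hΦ⟩, rfl⟩ := h
  -- the search predicate and the output, as functions of the input and an initial segment
  let val : ℕ → ℕ := fun p =>
    Encodable.encode ((Encodable.decode (α := α) p.unpair.1).bind fun a =>
      (Encodable.decode (α := List Bool) p.unpair.2).bind fun τ => φ τ a)
  have hval : Computable val := by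
    refine Computable.encode.comp ?_
    refine Computable.option_bind (Computable.decode.comp (Computable.fst.comp Computable.unpair)) ?_
    refine Computable.option_bind (f := fun q : ℕ × α => Encodable.decode (α := List Bool) q.1.unpair.2)
      (Computable.decode.comp (Computable.snd.comp (Computable.unpair.comp Computable.fst))) ?_
    exact hφ.comp Computable.snd (Computable.snd.comp Computable.fst)
  have e_val : ∀ a k, val (Nat.pair (Encodable.encode a) (Encodable.encode (initSeg B k))) =
      Encodable.encode (φ (initSeg B k) a) := by
    intro a k; simp [val]
  have toRec : ∀ {g : ℕ → ℕ}, Computable g → Nat.RecursiveIn (oracle B) fun n => Part.some (g n) :=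
    fun hg => Nat.Partrec.recursiveIn (Partrec.nat_iff.1 hg.partrec)
  have hl : Nat.RecursiveIn (oracle B) fun n => Part.some n.unpair.1 :=
    toRec (Computable.fst.comp Computable.unpair)
  have hr : Nat.RecursiveIn (oracle B) fun n => Part.some n.unpair.2 :=
    toRec (Computable.snd.comp Computable.unpair)
  have hid : Nat.RecursiveIn (oracle B) fun n => Part.some n := toRec Computable.id
  have hseg := (toRec hval).comp (hl.pair ((recursiveIn_initSeg B).comp hr))
  -- `none` is encoded by `0` and `some v` by a successor. So `1 - n` vanishes exactly on answers,
  -- which is what `rfind` looks for, and `Nat.pred` then strips the `some`.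
  have hone : Computable fun n : ℕ => 1 - n :=
    (Primrec.nat_sub.comp (Primrec.const 1) Primrec.id).to_comp
  have hpred : Computable Nat.pred := Computable.pred
  -- The identity restricted to codes of elements of `α`; it makes the composite undefined on every
  -- other number.
  have hdec : Nat.Partrec fun n => Part.bind (Encodable.decode (α := α) n : Part α) fun a =>
      (Part.some a).map Encodable.encode := Partrec.some
  have hmain := (toRec hpred).comp (hseg.comp (hid.pair (((toRec hone).comp hseg).rfind)))
  refine (hmain.comp hdec.recursiveIn).of_eq fun n => ?_
  simp only [Part.bind_eq_bind]
  cases hn : (Encodable.decode n : Option α) with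
  | none => simp
  | some a =>
    simp only [Part.coe_some, Part.bind_some, Part.map_some, Part.map_eq_map, Nat.unpair_pair,
      Seq.seq, e_val]
    obtain ⟨⟨k, hk⟩, hu⟩ := hΦ B a
    have hdom : (Nat.rfind fun k => Part.some (decide (1 - Encodable.encode (φ (initSeg B k) a) = 0))).Dom :=
      Nat.rfind_dom.2 ⟨k, by simp [hk], fun _ => trivial⟩
    obtain ⟨k', hk'⟩ := Part.dom_iff_mem.1 hdom
    have hs := Nat.rfind_spec hk'
    rw [Part.eq_some_iff.2 hk']
    simp only [Part.bind_some, Part.map_some, Nat.unpair_pair, e_val]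
    cases hφk : φ (initSeg B k') a with
    | none => simp [hφk] at hs
    | some v =>
      have := hu k' v hφk
      simp [this]

/-! ### The use principle for oracle computations. -/

/-- `G` computes `f` from the initial segments of `B`: longer segments give more values, and
the values so obtained are those of `f`. -/
structure SegApprox (B : Cantor) (f : ℕ →. ℕ) (G : List Bool → ℕ →. ℕ) : Prop where
  partrec : Partrec₂ G
  mono : ∀ {k k' n v}, k ≤ k' → v ∈ G (initSeg B k) n → v ∈ G (initSeg B k') n
  mem_iff : ∀ {n v}, v ∈ f n ↔ ∃ k, v ∈ G (initSeg B k) n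

/-- Finitely many facts that hold from some stage on hold simultaneously at some stage. -/
theorem exists_stage_forall_lt {P : ℕ → ℕ → Prop}
    (hmono : ∀ {m k k'}, k ≤ k' → P m k → P m k') {n : ℕ} (h : ∀ m < n, ∃ k, P m k) :
    ∃ k, ∀ m < n, P m k := by
  induction n with
  | zero => exact ⟨0, fun _ h => absurd h (Nat.not_lt_zero _)⟩
  | succ n ih =>
    obtain ⟨k, hk⟩ := ih fun m hm => h m (hm.trans (Nat.lt_succ_self n))
    obtain ⟨l, hl⟩ := h n (Nat.lt_succ_self n)
    refine ⟨max k l, fun m hm => ?_⟩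
    rcases Nat.lt_succ_iff_lt_or_eq.1 hm with hm | rfl
    · exact hmono (le_max_left _ _) (hk m hm)
    · exact hmono (le_max_right _ _) hl

namespace SegApprox

variable {B : Cantor} {f h : ℕ →. ℕ} {F H : List Bool → ℕ →. ℕ}

theorem of_partrec (hf : Nat.Partrec f) : SegApprox B f fun _ n => f n where
  partrec := (Partrec.nat_iff.2 hf).comp Computable.snd
  mono _ hv := hv
  mem_iff := by simp

/-- A query beyond the segment diverges instead of receiving a default answer; this is what makes
`mono` true. -/
theorem oracle : SegApprox B (fun n => Part.some (B n).toNat)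
    fun τ n => ((τ[n]?).map Bool.toNat : Option ℕ) where
  partrec := by
    refine Computable.ofOption ?_
    exact Computable.option_map (Computable.list_getElem?.comp Computable.fst Computable.snd)
      ((Primrec.dom_finite Bool.toNat).to_comp.comp Computable.snd)
  mono {k k' n v} hk hv := by
    simp only [Part.mem_ofOption, Option.mem_def, Option.map_eq_some_iff] at hv ⊢
    obtain ⟨b, hb, rfl⟩ := hv
    have hn : n < k := by
      by_contra hn
      simp [initSeg, hn] at hb
    rw [initSeg_getElem? B hn] at hb
    exact ⟨b, by rw [initSeg_getElem? B (hn.trans_le hk), hb], rfl⟩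
  mem_iff {n v} := by
    simp only [Part.mem_ofOption, Option.mem_def, Option.map_eq_some_iff, Part.mem_some_iff]
    constructor
    · rintro rfl
      exact ⟨n + 1, B n, initSeg_getElem? B (Nat.lt_succ_self n), rfl⟩
    · rintro ⟨k, b, hb, rfl⟩
      have hn : n < k := by
        by_contra hn
        simp [initSeg, hn] at hb
      rw [initSeg_getElem? B hn] at hb
      cases hb; rfl

theorem pair (hf : SegApprox B f F) (hh : SegApprox B h H) :
    SegApprox B (fun n => Nat.pair <$> f n <*> h n) fun τ n => Nat.pair <$> F τ n <*> H τ n where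
  partrec := by
    have h1 : Partrec fun q : (List Bool × ℕ) × ℕ => H q.1.1 q.1.2 :=
      Partrec.comp (f := fun p : List Bool × ℕ => H p.1 p.2) hh.partrec Computable.fst
    have h2 : Partrec₂ fun (p : List Bool × ℕ) (a : ℕ) => (H p.1 p.2).map (Nat.pair a) :=
      Partrec.map (f := fun q : (List Bool × ℕ) × ℕ => H q.1.1 q.1.2)
        (g := fun q b => Nat.pair q.2 b) h1
        (Primrec₂.natPair.to_comp.comp (Computable.snd.comp Computable.fst) Computable.snd)
    refine (Partrec.bind (f := fun p : List Bool × ℕ => F p.1 p.2) hf.partrec h2).of_eq fun p => ?_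
    simp [Seq.seq, Part.bind_map]
  mono {k k' n v} hk hv := by
    simp only [Seq.seq, Part.map_eq_map, Part.mem_bind_iff, Part.mem_map_iff] at hv ⊢
    obtain ⟨_, ⟨a, ha, rfl⟩, b, hb, rfl⟩ := hv
    exact ⟨_, ⟨a, hf.mono hk ha, rfl⟩, b, hh.mono hk hb, rfl⟩
  mem_iff {n v} := by
    simp only [Seq.seq, Part.map_eq_map, Part.mem_bind_iff, Part.mem_map_iff]
    constructor
    · rintro ⟨_, ⟨a, ha, rfl⟩, b, hb, rfl⟩
      obtain ⟨k, hk⟩ := hf.mem_iff.1 ha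
      obtain ⟨l, hl⟩ := hh.mem_iff.1 hb
      exact ⟨max k l, _, ⟨a, hf.mono (le_max_left _ _) hk, rfl⟩, b,
        hh.mono (le_max_right _ _) hl, rfl⟩
    · rintro ⟨k, _, ⟨a, ha, rfl⟩, b, hb, rfl⟩
      exact ⟨_, ⟨a, hf.mem_iff.2 ⟨k, ha⟩, rfl⟩, b, hh.mem_iff.2 ⟨k, hb⟩, rfl⟩

theorem comp (hf : SegApprox B f F) (hh : SegApprox B h H) :
    SegApprox B (fun n => h n >>= f) fun τ n => H τ n >>= F τ where
  partrec := Partrec.bind (f := fun p : List Bool × ℕ => H p.1 p.2) hh.partrec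
    (Partrec.comp (f := fun p : List Bool × ℕ => F p.1 p.2) hf.partrec
      (Computable.pair (Computable.fst.comp Computable.fst) Computable.snd))
  mono {k k' n v} hk hv := by
    obtain ⟨a, ha, hv⟩ := Part.mem_bind_iff.1 hv
    exact Part.mem_bind_iff.2 ⟨a, hh.mono hk ha, hf.mono hk hv⟩
  mem_iff {n v} := by
    constructor
    · intro hv
      obtain ⟨a, ha, hv⟩ := Part.mem_bind_iff.1 hv
      obtain ⟨k, hk⟩ := hh.mem_iff.1 ha
      obtain ⟨l, hl⟩ := hf.mem_iff.1 hv
      exact ⟨max k l, Part.mem_bind_iff.2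
        ⟨a, hh.mono (le_max_left _ _) hk, hf.mono (le_max_right _ _) hl⟩⟩
    · rintro ⟨k, hv⟩
      obtain ⟨a, ha, hv⟩ := Part.mem_bind_iff.1 hv
      exact Part.mem_bind_iff.2 ⟨a, hh.mem_iff.2 ⟨k, ha⟩, hf.mem_iff.2 ⟨k, hv⟩⟩

/-- Primitive recursion of partial functions. -/
def precPart (f h : ℕ →. ℕ) (a n : ℕ) : Part ℕ :=
  n.rec (f a) fun y IH => IH.bind fun i => h (Nat.pair a (Nat.pair y i))

theorem prec (hf : SegApprox B f F) (hh : SegApprox B h H) :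
    SegApprox B (fun p => precPart f h p.unpair.1 p.unpair.2)
      fun τ p => precPart (F τ) (H τ) p.unpair.1 p.unpair.2 where
  partrec := by
    have h1 : Computable fun p : List Bool × ℕ => p.2.unpair.1 :=
      Computable.fst.comp (Computable.unpair.comp Computable.snd)
    have h2 : Computable fun p : List Bool × ℕ => p.2.unpair.2 :=
      Computable.snd.comp (Computable.unpair.comp Computable.snd)
    refine (Partrec.nat_rec (f := fun p : List Bool × ℕ => p.2.unpair.2)
      (g := fun p => F p.1 p.2.unpair.1)
      (h := fun p q => H p.1 (Nat.pair p.2.unpair.1 (Nat.pair q.1 q.2))) h2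
      (hf.partrec.comp (f := fun τ n => F τ n) Computable.fst h1) ?_)
    refine Partrec₂.comp (f := fun τ n => H τ n) hh.partrec (Computable.fst.comp Computable.fst) ?_
    exact Primrec₂.natPair.to_comp.comp (h1.comp Computable.fst)
      (Primrec₂.natPair.to_comp.comp (Computable.fst.comp Computable.snd)
        (Computable.snd.comp Computable.snd))
  mono {k k' n v} hk hv := by
    revert v
    generalize n.unpair.1 = a
    induction n.unpair.2 with
    | zero => exact fun hv => hf.mono hk hv
    | succ m ih =>
      intro v hv
      obtain ⟨i, hi, hv⟩ := Part.mem_bind_iff.1 hv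
      exact Part.mem_bind_iff.2 ⟨i, ih hi, hh.mono hk hv⟩
  mem_iff {n v} := by
    revert v
    generalize n.unpair.1 = a
    have hmono : ∀ m {k k' v}, k ≤ k' → v ∈ precPart (F (initSeg B k)) (H (initSeg B k)) a m →
        v ∈ precPart (F (initSeg B k')) (H (initSeg B k')) a m := by
      intro m k k' v hk hv
      revert v
      induction m with
      | zero => exact fun hv => hf.mono hk hv
      | succ m ih =>
        intro v hv
        obtain ⟨i, hi, hv⟩ := Part.mem_bind_iff.1 hv
        exact Part.mem_bind_iff.2 ⟨i, ih hi, hh.mono hk hv⟩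
    induction n.unpair.2 with
    | zero => exact hf.mem_iff
    | succ m ih =>
      intro v
      constructor
      · intro hv
        obtain ⟨i, hi, hv⟩ := Part.mem_bind_iff.1 hv
        obtain ⟨k, hk⟩ := ih.1 hi
        obtain ⟨l, hl⟩ := hh.mem_iff.1 hv
        exact ⟨max k l, Part.mem_bind_iff.2
          ⟨i, hmono m (le_max_left _ _) hk, hh.mono (le_max_right _ _) hl⟩⟩
      · rintro ⟨k, hv⟩
        obtain ⟨i, hi, hv⟩ := Part.mem_bind_iff.1 hv
        exact Part.mem_bind_iff.2 ⟨i, ih.2 ⟨k, hi⟩, hh.mem_iff.2 ⟨k, hv⟩⟩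

theorem mem_rfind_eq_zero {g : ℕ → Part ℕ} {v : ℕ} :
    v ∈ Nat.rfind (fun n => (fun m => decide (m = 0)) <$> g n) ↔
      0 ∈ g v ∧ ∀ m < v, ∃ b ∈ g m, b ≠ 0 := by
  refine Nat.mem_rfind.trans (and_congr ?_ (forall₂_congr fun m _ => ?_))
  · simp
  · simp

/-- A successful minimisation rests on finitely many convergent values: zero at the result and
nonzero below it. By monotonicity they all appear on one common segment. -/
theorem rfind (hf : SegApprox B f F) :
    SegApprox B (fun a => Nat.rfind fun n => (fun m => decide (m = 0)) <$> f (Nat.pair a n))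
      fun τ a => Nat.rfind fun n => (fun m => decide (m = 0)) <$> F τ (Nat.pair a n) where
  partrec := by
    refine Partrec.rfind (p := fun p : List Bool × ℕ => fun n =>
      (fun m => decide (m = 0)) <$> F p.1 (Nat.pair p.2 n)) ?_
    refine Partrec.map (f := fun q : (List Bool × ℕ) × ℕ => F q.1.1 (Nat.pair q.1.2 q.2)) ?_ ?_
    · exact Partrec₂.comp (f := fun τ n => F τ n) hf.partrec (Computable.fst.comp Computable.fst)
        (Primrec₂.natPair.to_comp.comp (Computable.snd.comp Computable.fst) Computable.snd)
    · exact (Primrec.eq.comp Primrec.snd (Primrec.const 0)).decide.to_comp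
  mono {k k' n v} hk hv := by
    obtain ⟨h0, hv⟩ := mem_rfind_eq_zero.1 hv
    refine mem_rfind_eq_zero.2 ⟨hf.mono hk h0, fun m hm => ?_⟩
    obtain ⟨b, hb, h1⟩ := hv m hm
    exact ⟨b, hf.mono hk hb, h1⟩
  mem_iff {n v} := by
    refine mem_rfind_eq_zero.trans (Iff.trans ?_ (exists_congr fun k => mem_rfind_eq_zero.symm))
    constructor
    · rintro ⟨h0, hv⟩
      obtain ⟨k, hk⟩ := hf.mem_iff.1 h0
      have : ∃ l, ∀ m < v, ∃ b ∈ F (initSeg B l) (Nat.pair n m), b ≠ 0 := by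
        refine exists_stage_forall_lt
          (P := fun m l => ∃ b ∈ F (initSeg B l) (Nat.pair n m), b ≠ 0) ?_ ?_
        · rintro m k k' hk ⟨b, hb, h1⟩
          exact ⟨b, hf.mono hk hb, h1⟩
        · intro m hm
          obtain ⟨b, hb, h1⟩ := hv m hm
          obtain ⟨l, hl⟩ := hf.mem_iff.1 hb
          exact ⟨l, b, hl, h1⟩
      obtain ⟨l, hl⟩ := this
      refine ⟨max k l, hf.mono (le_max_left _ _) hk, fun m hm => ?_⟩
      obtain ⟨b, hb, h1⟩ := hl m hm
      exact ⟨b, hf.mono (le_max_right _ _) hb, h1⟩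
    · rintro ⟨k, h0, hv⟩
      refine ⟨hf.mem_iff.2 ⟨k, h0⟩, fun m hm => ?_⟩
      obtain ⟨b, hb, h1⟩ := hv m hm
      exact ⟨b, hf.mem_iff.2 ⟨k, hb⟩, h1⟩

end SegApprox

/-- A halting computation consults only finitely many bits of its oracle. The induction follows the
schemes that generate the functions recursive in `B`. -/
theorem exists_segApprox {B : Cantor} {f : ℕ →. ℕ} (hf : Nat.RecursiveIn (oracle B) f) :
    ∃ G, SegApprox B f G := by
  induction hf with
  | zero => exact ⟨_, .of_partrec .zero⟩
  | succ => exact ⟨_, .of_partrec .succ⟩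
  | left => exact ⟨_, .of_partrec .left⟩
  | right => exact ⟨_, .of_partrec .right⟩
  | oracle g hg =>
    obtain rfl : g = _ := hg
    exact ⟨_, .oracle⟩
  | pair _ _ ih₁ ih₂ =>
    obtain ⟨_, h₁⟩ := ih₁
    obtain ⟨_, h₂⟩ := ih₂
    exact ⟨_, h₁.pair h₂⟩
  | comp _ _ ih₁ ih₂ =>
    obtain ⟨_, h₁⟩ := ih₁
    obtain ⟨_, h₂⟩ := ih₂
    exact ⟨_, h₁.comp h₂⟩
  | prec _ _ ih₁ ih₂ =>
    obtain ⟨_, h₁⟩ := ih₁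
    obtain ⟨_, h₂⟩ := ih₂
    exact ⟨_, h₁.prec h₂⟩
  | rfind _ ih =>
    obtain ⟨_, h⟩ := ih
    exact ⟨_, h.rfind⟩

/-- A function computable in `B` is approximated by a computable function of the number of steps
and of an initial segment of `B`. -/
theorem exists_stage_approx {α σ : Type} [Primcodable α] [Primcodable σ] {B : Cantor} {c : α → σ}
    (hc : ComputableIn (oracle B) c) :
    ∃ ψ : (ℕ × List Bool) × α → Option σ, Computable ψ ∧
      (∀ t k a v, ψ ((t, initSeg B k), a) = some v → v = c a) ∧
      ∀ l : ℕ → α, ∀ s, ∃ t k, ∀ i < s, ψ ((t, initSeg B k), l i) = some (c (l i)) := by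
  obtain ⟨G, hG⟩ := exists_segApprox hc
  obtain ⟨e, he⟩ := Nat.Partrec.Code.exists_code.1 (show Nat.Partrec _ from hG.partrec)
  have heval : ∀ (τ : List Bool) (n : ℕ),
      e.eval (Encodable.encode (τ, n)) = G τ n := by
    intro τ n
    rw [he]
    simp [Part.map_id']
  have hmem : ∀ a v, v ∈ ((Encodable.decode (α := α) (Encodable.encode a) : Option α) : Part α).bind
      (fun a => (Part.some (c a)).map Encodable.encode) ↔ v = Encodable.encode (c a) := by
    simp
  -- The step bound in `evaln` turns the partial `G` into a total function; both completeness of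
  -- `evaln` and monotonicity in the segment provide common bounds for finitely many inputs.
  refine ⟨fun p => (Nat.Partrec.Code.evaln p.1.1 e
      (Encodable.encode (p.1.2, Encodable.encode p.2))).bind Encodable.decode, ?_, ?_, ?_⟩
  · refine Computable.option_bind (Primrec.to_comp ?_) (Computable.decode.comp Computable.snd)
    refine Nat.Partrec.Code.primrec_evaln.comp (Primrec.pair (Primrec.pair
      (Primrec.fst.comp Primrec.fst) (Primrec.const e)) (Primrec.encode.comp (Primrec.pair
        (Primrec.snd.comp Primrec.fst) (Primrec.encode.comp Primrec.snd))))
  · intro t k a v hv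
    obtain ⟨x, hx, hd⟩ := Option.bind_eq_some_iff.1 hv
    have hx' := Nat.Partrec.Code.evaln_sound hx
    rw [heval] at hx'
    have := (hmem a x).1 (hG.mem_iff.2 ⟨k, hx'⟩)
    rw [this, Encodable.encodek] at hd
    exact (Option.some.inj hd).symm
  · intro l s
    obtain ⟨k, hk⟩ := exists_stage_forall_lt
      (P := fun i k => Encodable.encode (c (l i)) ∈ G (initSeg B k) (Encodable.encode (l i)))
      (fun hk h => hG.mono hk h) (n := s)
      (fun i _ => hG.mem_iff.1 ((hmem (l i) _).2 rfl))
    obtain ⟨t, ht⟩ := exists_stage_forall_lt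
      (P := fun i t => Encodable.encode (c (l i)) ∈ Nat.Partrec.Code.evaln t e
        (Encodable.encode (initSeg B k, Encodable.encode (l i))))
      (fun ht h => Nat.Partrec.Code.evaln_mono ht h) (n := s)
      (fun i hi => Nat.Partrec.Code.evaln_complete.1 (by rw [heval]; exact hk i hi))
    refine ⟨t, k, fun i hi => ?_⟩
    change Option.bind _ _ = _
    rw [Option.mem_def.1 (ht i hi), Option.bind_some, Encodable.encodek]

/-! ### Initial intervals of the lexicographic order -/

/-- The number with binary digits `X 0, …, X (M - 1)`, most significant digit first. -/
def binVal (X : Cantor) : ℕ → ℕ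
  | 0 => 0
  | M + 1 => 2 * binVal X M + (X M).toNat

/-- The sequences whose first `M` digits represent a number below `j`. -/
def lowSet (M j : ℕ) : Set Cantor := {X | binVal X M < j}

/-- The `M` last binary digits of `i`, most significant digit first. -/
def digits (M i : ℕ) : List Bool := (List.range M).map fun p => decide (i / 2 ^ (M - 1 - p) % 2 = 1)

theorem digits_length (M i : ℕ) : (digits M i).length = M := by simp [digits]

theorem digits_succ (M i : ℕ) : digits (M + 1) i = digits M (i / 2) ++ [decide (i % 2 = 1)] := by
  simp only [digits, List.range_succ, List.map_append, List.map_cons, List.map_nil]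
  congr 1
  · refine List.map_congr_left fun p hp => ?_
    have hp := List.mem_range.1 hp
    rw [Nat.div_div_eq_div_mul, ← pow_succ', show M + 1 - 1 - p = M - 1 - p + 1 by omega]
  · simp

theorem binVal_lt (X : Cantor) (M : ℕ) : binVal X M < 2 ^ M := by
  induction M with
  | zero => simp [binVal]
  | succ M ih =>
    have := Bool.toNat_le (X M)
    rw [binVal, pow_succ]
    omega

theorem initSeg_eq_digits (X : Cantor) (M : ℕ) : initSeg X M = digits M (binVal X M) := by
  induction M with
  | zero => simp [initSeg, digits]
  | succ M ih =>
    rw [initSeg_succ, digits_succ, ih, binVal]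
    cases X M
    · simp
    · simp [Nat.mul_add_div]

theorem binVal_eq_of_initSeg {X : Cantor} {M i : ℕ} (hi : i < 2 ^ M) (h : initSeg X M = digits M i) :
    binVal X M = i := by
  induction M generalizing i with
  | zero => simp at hi; simp [binVal, hi]
  | succ M ih =>
    rw [initSeg_succ, digits_succ] at h
    have h' := List.append_inj h (by simp [initSeg_length, digits_length])
    rw [binVal, ih (by rw [pow_succ] at hi; omega) h'.1, show X M = _ from List.singleton_inj.1 h'.2]
    rcases Nat.mod_two_eq_zero_or_one i with h0 | h0
    · simp [h0]; omega
    · simp [h0]; omega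

theorem basicOpen_digits {M i : ℕ} (hi : i < 2 ^ M) :
    basicOpen (some (digits M i)) = {X | binVal X M = i} := by
  ext X
  change initSeg X (digits M i).length = digits M i ↔ binVal X M = i
  rw [digits_length]
  exact ⟨binVal_eq_of_initSeg hi, fun h => h ▸ initSeg_eq_digits X M⟩

theorem exists_binVal_eq {M i : ℕ} (hi : i < 2 ^ M) : ∃ X : Cantor, {Y | binVal Y M = i} = cyl X M := by
  obtain ⟨X, hX⟩ := basicOpen_some_eq_cyl (digits M i)
  exact ⟨X, by rw [← basicOpen_digits hi, hX, digits_length]⟩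

theorem measurableSet_binVal_eq (M i : ℕ) : MeasurableSet {X : Cantor | binVal X M = i} := by
  by_cases hi : i < 2 ^ M
  · rw [← basicOpen_digits hi]; exact measurableSet_basicOpen _
  · convert MeasurableSet.empty
    ext X
    have := binVal_lt X M
    simp; omega

theorem fairCoin_binVal_eq {M i : ℕ} (hi : i < 2 ^ M) :
    fairCoin.real {X | binVal X M = i} = (1 / 2) ^ M := by
  obtain ⟨X, hX⟩ := exists_binVal_eq hi
  rw [hX, fairCoin_real_cyl]

theorem fairCoin_binVal_eq_le (M i : ℕ) : fairCoin.real {X | binVal X M = i} ≤ (1 / 2) ^ M := by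
  by_cases hi : i < 2 ^ M
  · exact (fairCoin_binVal_eq hi).le
  · have : {X : Cantor | binVal X M = i} = ∅ := by
      ext X
      have := binVal_lt X M
      simp; omega
    rw [this, measureReal_empty]; positivity

theorem measurableSet_lowSet (M j : ℕ) : MeasurableSet (lowSet M j) := by
  have : lowSet M j = ⋃ i ∈ Set.Iio j, {X | binVal X M = i} := by
    ext X; simp [lowSet]
  rw [this]
  exact MeasurableSet.biUnion (Set.to_countable _) fun i _ => measurableSet_binVal_eq M i

/-- Passing to a finer grid does not change the interval. Intervals from different grids become
comparable on a common refinement, and grids may later be refined at will. -/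
theorem lowSet_add (M r j : ℕ) : lowSet (M + r) (2 ^ r * j) = lowSet M j := by
  induction r with
  | zero => simp
  | succ r ih =>
    rw [← ih, ← add_assoc]
    ext X
    have := Bool.toNat_le (X (M + r))
    change 2 * binVal X (M + r) + (X (M + r)).toNat < 2 ^ (r + 1) * j ↔ binVal X (M + r) < 2 ^ r * j
    rw [pow_succ', mul_assoc]
    omega

theorem lowSet_mono (M : ℕ) {i j : ℕ} (h : i ≤ j) : lowSet M i ⊆ lowSet M j :=
  fun _ hX => lt_of_lt_of_le hX h

theorem lowSet_total (M i N j : ℕ) : lowSet M i ⊆ lowSet N j ∨ lowSet N j ⊆ lowSet M i := by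
  rw [← lowSet_add M N i, ← lowSet_add N M j, add_comm N M]
  exact (le_total _ _).imp (lowSet_mono _) (lowSet_mono _)

theorem lowSet_eq_univ {M j : ℕ} (h : 2 ^ M ≤ j) : lowSet M j = Set.univ :=
  Set.eq_univ_of_forall fun X => (binVal_lt X M).trans_le h

/-- Adding to `U` the initial intervals that keep the measure below `δ` yields a set of measure
exactly `δ`. -/
theorem fairCoin_fill {U : Set Cantor} {δ : ℝ} (hU' : fairCoin.real U ≤ δ)
    (hδ : δ ≤ 1) :
    fairCoin.real (U ∪ ⋃ p ∈ {p : ℕ × ℕ | fairCoin.real (U ∪ lowSet p.1 p.2) < δ},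
      lowSet p.1 p.2) = δ := by
  set R := {p : ℕ × ℕ | fairCoin.real (U ∪ lowSet p.1 p.2) < δ} with hR
  -- If no interval qualifies, the empty interval `(0, 0)` does not, so `U` already has measure `δ`.
  rcases R.eq_empty_or_nonempty with hempty | hne
  · have h0 : ((0, 0) : ℕ × ℕ) ∉ R := by simp [hempty]
    have : fairCoin.real U = δ := by
      refine le_antisymm hU' (not_lt.1 fun h => h0 ?_)
      simpa [hR, lowSet] using h
    simp [hempty, this]
  have hne' : Nonempty R := hne.to_subtype
  have hV : (U ∪ ⋃ p ∈ R, lowSet p.1 p.2) = ⋃ p : R, (U ∪ lowSet p.1.1 p.1.2) := by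
    rw [Set.biUnion_eq_iUnion, Set.union_iUnion]
  rw [hV]
  apply le_antisymm
  · have hdir : Directed (· ⊆ ·) fun p : R => U ∪ lowSet p.1.1 p.1.2 := by
      intro p q
      rcases lowSet_total p.1.1 p.1.2 q.1.1 q.1.2 with h | h
      · exact ⟨q, Set.union_subset_union_right _ h, subset_rfl⟩
      · exact ⟨p, subset_rfl, Set.union_subset_union_right _ h⟩
    have hle : fairCoin (⋃ p : R, (U ∪ lowSet p.1.1 p.1.2)) ≤ ENNReal.ofReal δ := by
      rw [hdir.measure_iUnion]
      refine iSup_le fun p => ?_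
      rw [← ofReal_measureReal]
      exact ENNReal.ofReal_le_ofReal (le_of_lt p.2)
    exact ENNReal.toReal_le_of_le_ofReal (measureReal_nonneg.trans hU') hle
  · refine le_of_forall_pos_le_add fun ε hε => ?_
    -- On a grid of mesh below `ε`, take the first interval that does not qualify; one exists
    -- because the full interval has measure `1 ≥ δ`. Its predecessor qualifies and loses at most
    -- `ε`.
    obtain ⟨M, hM⟩ := exists_pow_lt_of_lt_one hε (show (1 / 2 : ℝ) < 1 by norm_num)
    have hex : ∃ j, (M, j) ∉ R := by
      refine ⟨2 ^ M, fun h => ?_⟩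
      have h : fairCoin.real (U ∪ lowSet M (2 ^ M)) < δ := h
      rw [lowSet_eq_univ le_rfl, Set.union_univ, probReal_univ] at h
      linarith
    classical
    obtain ⟨j, hj, hmin⟩ : ∃ j, (M, j) ∉ R ∧ ∀ i < j, (M, i) ∈ R :=
      ⟨Nat.find hex, Nat.find_spec hex, fun i hi => not_not.1 (Nat.find_min hex hi)⟩
    have hj : δ ≤ fairCoin.real (U ∪ lowSet M j) := not_lt.1 hj
    cases j with
    | zero =>
      obtain ⟨p⟩ := hne'
      have h1 : fairCoin.real (U ∪ lowSet M 0) ≤ fairCoin.real (⋃ p : R, (U ∪ lowSet p.1.1 p.1.2)) := by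
        refine measureReal_mono ?_
        have : lowSet M 0 = ∅ := by ext X; simp [lowSet]
        rw [this, Set.union_empty]
        exact Set.subset_iUnion_of_subset p Set.subset_union_left
      linarith
    | succ j =>
      have h1 : fairCoin.real (U ∪ lowSet M j) ≤ fairCoin.real (⋃ p : R, (U ∪ lowSet p.1.1 p.1.2)) :=
        measureReal_mono (Set.subset_iUnion (fun p : R => U ∪ lowSet p.1.1 p.1.2)
          ⟨(M, j), hmin j (Nat.lt_succ_self j)⟩)
      have h2 : U ∪ lowSet M (j + 1) ⊆ (U ∪ lowSet M j) ∪ {X | binVal X M = j} := by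
        rintro X (hX | hX)
        · exact Or.inl (Or.inl hX)
        · rcases Nat.lt_succ_iff_lt_or_eq.1 hX with h | h
          · exact Or.inl (Or.inr h)
          · exact Or.inr h
      have h3 := (measureReal_mono (μ := fairCoin) h2).trans (measureReal_union_le _ _)
      have h4 := fairCoin_binVal_eq_le M j
      linarith

/-! ### Counting digit strings outside a finite list of basic open sets -/

/-- Some initial segment of `x` names the basic open set `o`. -/
def Hit (x : List Bool) (o : Option (List Bool)) : Prop := ∃ p < x.length + 1, o = some (x.take p)

instance (x : List Bool) (o : Option (List Bool)) : Decidable (Hit x o) := by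
  unfold Hit; infer_instance

/-- The number of `i < j` such that no set in `L` contains the cylinder of `digits M i`. -/
def missCount (L : List (Option (List Bool))) (M j : ℕ) : ℕ :=
  ((List.range j).filter fun i => ∀ o ∈ L, ¬ Hit (digits M i) o).length

/-- The union of the basic open sets in a finite list. -/
def listUnion (L : List (Option (List Bool))) : Set Cantor := {X | ∃ o ∈ L, X ∈ basicOpen o}

theorem initSeg_take (X : Cantor) {p M : ℕ} (h : p ≤ M) : (initSeg X M).take p = initSeg X p := by
  simp [initSeg, ← List.map_take, List.take_range, h]

theorem mem_basicOpen_of_hit {X : Cantor} {M : ℕ} {o : Option (List Bool)}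
    (h : Hit (initSeg X M) o) : X ∈ basicOpen o := by
  obtain ⟨p, hp, rfl⟩ := h
  rw [initSeg_length] at hp
  rw [initSeg_take X (Nat.lt_succ_iff.1 hp)]
  change initSeg X (initSeg X p).length = _
  rw [initSeg_length]

theorem hit_of_mem_basicOpen {X : Cantor} {M : ℕ} {o : Option (List Bool)}
    (h : X ∈ basicOpen o) (hM : ∀ ρ, o = some ρ → ρ.length ≤ M) : Hit (initSeg X M) o := by
  cases o with
  | none => exact h.elim
  | some ρ =>
    have hρ := hM ρ rfl
    refine ⟨ρ.length, by rw [initSeg_length]; omega, ?_⟩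
    rw [initSeg_take X hρ]
    exact congrArg some (Eq.symm h)

theorem missCount_eq_card (L : List (Option (List Bool))) (M j : ℕ) :
    missCount L M j =
      ((Finset.range j).filter fun i => ∀ o ∈ L, ¬ Hit (digits M i) o).card := rfl

/-- No bound on the strings in `L` is needed: longer ones may cover a cylinder partially, and
counting such a cylinder as missed only overestimates. -/
theorem fairCoin_lowSet_diff_le (L : List (Option (List Bool))) (M j : ℕ) :
    fairCoin.real (lowSet M j \ listUnion L) ≤ missCount L M j * (1 / 2) ^ M := by
  rw [missCount_eq_card]
  set S := (Finset.range j).filter fun i => ∀ o ∈ L, ¬ Hit (digits M i) o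
  have hsub : lowSet M j \ listUnion L ⊆ ⋃ i ∈ S, {X | binVal X M = i} := by
    rintro X ⟨hX, hL⟩
    refine Set.mem_biUnion (x := binVal X M) ?_ rfl
    refine Finset.mem_coe.2 (Finset.mem_filter.2 ⟨Finset.mem_range.2 hX, fun o ho hh => hL ⟨o, ho, ?_⟩⟩)
    rw [← initSeg_eq_digits] at hh
    exact mem_basicOpen_of_hit hh
  calc fairCoin.real (lowSet M j \ listUnion L)
      ≤ fairCoin.real (⋃ i ∈ S, {X | binVal X M = i}) :=
        measureReal_mono hsub (measure_ne_top _ _)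
    _ ≤ ∑ i ∈ S, fairCoin.real {X | binVal X M = i} := measureReal_biUnion_finset_le _ _
    _ ≤ ∑ i ∈ S, (1 / 2 : ℝ) ^ M := Finset.sum_le_sum fun i _ => fairCoin_binVal_eq_le M i
    _ = S.card * (1 / 2) ^ M := by rw [Finset.sum_const, nsmul_eq_mul]

/-- When no string in `L` is longer than `M`, each cylinder of length `M` lies inside the union or
is disjoint from it, so the count is exact. -/
theorem missCount_le_fairCoin {L : List (Option (List Bool))} {M j : ℕ} (hj : j ≤ 2 ^ M)
    (hL : ∀ ρ, some ρ ∈ L → ρ.length ≤ M) :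
    missCount L M j * (1 / 2) ^ M ≤ fairCoin.real (lowSet M j \ listUnion L) := by
  rw [missCount_eq_card]
  set S := (Finset.range j).filter fun i => ∀ o ∈ L, ¬ Hit (digits M i) o
  have hS : ∀ i ∈ S, i < j := fun i hi => Finset.mem_range.1 (Finset.mem_filter.1 hi).1
  have hsub : (⋃ i ∈ S, {X | binVal X M = i}) ⊆ lowSet M j \ listUnion L := by
    intro X hX
    obtain ⟨i, hi, rfl⟩ := Set.mem_iUnion₂.1 hX
    refine ⟨hS _ hi, ?_⟩
    rintro ⟨o, ho, hX⟩
    refine (Finset.mem_filter.1 hi).2 o ho ?_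
    rw [← initSeg_eq_digits]
    exact hit_of_mem_basicOpen hX fun ρ hρ => hL ρ (hρ ▸ ho)
  calc (S.card : ℝ) * (1 / 2) ^ M = ∑ i ∈ S, fairCoin.real {X | binVal X M = i} := by
        rw [Finset.sum_congr rfl fun i hi => fairCoin_binVal_eq ((hS i hi).trans_le hj),
          Finset.sum_const, nsmul_eq_mul]
    _ = fairCoin.real (⋃ i ∈ S, {X | binVal X M = i}) := by
        refine (measureReal_biUnion_finset ?_ fun i _ => measurableSet_binVal_eq M i).symm
        intro a _ b _ hab
        exact Set.disjoint_left.2 fun X (hX : binVal X M = a) (hX' : binVal X M = b) =>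
          hab (hX.symm.trans hX')
    _ ≤ _ := measureReal_mono hsub

/-! ### Computability of the counting argument -/

theorem primrec_pow : Primrec₂ ((· ^ ·) : ℕ → ℕ → ℕ) :=
  Primrec₂.unpaired'.1 Nat.Primrec.pow

theorem primrec_digits : Primrec₂ digits := by
  refine Primrec.list_map (Primrec.list_range.comp Primrec.fst) ?_
  refine (Primrec.eq.comp ?_ (Primrec.const 1)).decide
  refine Primrec.nat_mod.comp (Primrec.nat_div.comp (Primrec.snd.comp Primrec.fst) ?_)
    (Primrec.const 2)
  exact primrec_pow.comp (Primrec.const 2) (Primrec.nat_sub.comp (Primrec.nat_sub.comp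
    (Primrec.fst.comp Primrec.fst) (Primrec.const 1)) Primrec.snd)

theorem primrec_hit : PrimrecRel Hit := by
  have h : PrimrecRel fun (p : ℕ) (y : List Bool × Option (List Bool)) =>
      y.2 = some (y.1.take p) :=
    Primrec.eq.comp (Primrec.snd.comp Primrec.snd) (Primrec.option_some.comp
      (Primrec.list_take.comp Primrec.fst (Primrec.fst.comp Primrec.snd)))
  have h' := h.exists_mem_list.comp (f := fun y : List Bool × Option (List Bool) =>
    List.range (y.1.length + 1)) (g := fun y => y) (Primrec.list_range.comp (Primrec.succ.comp
      (Primrec.list_length.comp Primrec.fst))) Primrec.id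
  exact h'.of_eq fun y => by simp [Hit]

theorem primrec_missCount {α : Type} [Primcodable α] {L : α → List (Option (List Bool))}
    {M j : α → ℕ} (hL : Primrec L) (hM : Primrec M) (hj : Primrec j) :
    Primrec fun a => missCount (L a) (M a) (j a) := by
  have h1 : PrimrecRel fun (o : Option (List Bool)) (x : List Bool) => ¬ Hit x o :=
    (primrec_hit.comp Primrec.snd Primrec.fst).not
  have h2 : PrimrecRel fun (i : ℕ) (b : List (Option (List Bool)) × ℕ) =>
      ∀ o ∈ b.1, ¬ Hit (digits b.2 i) o :=
    h1.forall_mem_list.comp (Primrec.fst.comp Primrec.snd)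
      (primrec_digits.comp (Primrec.snd.comp Primrec.snd) Primrec.fst)
  exact Primrec.list_length.comp (h2.listFilter.comp (Primrec.list_range.comp hj)
    (Primrec.pair hL hM))

theorem computable_range_map {α σ : Type} [Primcodable α] [Primcodable σ] {f : α → ℕ}
    {g : α → ℕ → σ} (hf : Computable f) (hg : Computable₂ g) :
    Computable fun a => (List.range (f a)).map (g a) := by
  have : Computable fun a => Nat.rec (motive := fun _ => List σ) [] (fun i l => l ++ [g a i]) (f a) := by
    refine Computable.nat_rec (h := fun a p => p.2 ++ [g a p.1]) hf (Computable.const []) ?_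
    exact Computable.list_concat.comp (Computable.snd.comp Computable.snd)
      (hg.comp Computable.fst (Computable.fst.comp Computable.snd))
  refine this.of_eq fun a => ?_
  induction f a with
  | zero => rfl
  | succ n ih => simp only [ih, List.range_succ, List.map_append, List.map_cons, List.map_nil]

/-- The inequality `N * 2 ^ (-M) + ratOfCode q + 2 ^ (-s) < 2 ^ (-n)`, cleared of denominators. -/
def SmallEnough (n s M N : ℕ) (q : ℕ × ℕ × ℕ) : Prop :=
  N * (q.2.2 + 1) * 2 ^ s * 2 ^ n + q.1 * 2 ^ M * 2 ^ s * 2 ^ n + (q.2.2 + 1) * 2 ^ M * 2 ^ n <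
    (q.2.2 + 1) * 2 ^ M * 2 ^ s + q.2.1 * 2 ^ M * 2 ^ s * 2 ^ n

instance (n s M N : ℕ) (q : ℕ × ℕ × ℕ) : Decidable (SmallEnough n s M N q) := by
  unfold SmallEnough; infer_instance

theorem smallEnough_iff {n s M N : ℕ} {q : ℕ × ℕ × ℕ} :
    SmallEnough n s M N q ↔
      (N : ℝ) * (1 / 2) ^ M + (ratOfCode q : ℝ) + (1 / 2) ^ s < (1 / 2) ^ n := by
  obtain ⟨a, b, c⟩ := q
  have hc : (0 : ℝ) < c + 1 := by positivity
  have hpos : (0 : ℝ) < (c + 1) * 2 ^ M * 2 ^ s * 2 ^ n := by positivity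
  rw [← mul_lt_mul_iff_of_pos_right hpos]
  have e1 : ((N : ℝ) * (1 / 2) ^ M + (ratOfCode (a, b, c) : ℝ) + (1 / 2) ^ s) *
      ((c + 1) * 2 ^ M * 2 ^ s * 2 ^ n) =
      N * (c + 1) * 2 ^ s * 2 ^ n + a * 2 ^ M * 2 ^ s * 2 ^ n + (c + 1) * 2 ^ M * 2 ^ n -
        b * 2 ^ M * 2 ^ s * 2 ^ n := by
    simp only [ratOfCode, one_div, inv_pow]
    push_cast
    field_simp
    ring
  have e2 : (1 / 2 : ℝ) ^ n * ((c + 1) * 2 ^ M * 2 ^ s * 2 ^ n) = (c + 1) * 2 ^ M * 2 ^ s := by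
    simp only [one_div, inv_pow]
    field_simp
  rw [e1, e2, sub_lt_iff_lt_add, SmallEnough]
  exact_mod_cast Iff.rfl

theorem primrec_smallEnough {α : Type} [Primcodable α] {n s M N : α → ℕ} {q : α → ℕ × ℕ × ℕ}
    (hn : Primrec n) (hs : Primrec s) (hM : Primrec M) (hN : Primrec N) (hq : Primrec q) :
    PrimrecPred fun x => SmallEnough (n x) (s x) (M x) (N x) (q x) := by
  have two : ∀ {f : α → ℕ}, Primrec f → Primrec fun p => 2 ^ f p :=
    fun h => primrec_pow.comp (Primrec.const 2) h
  have ha : Primrec fun x => (q x).1 := Primrec.fst.comp hq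
  have hb : Primrec fun x => (q x).2.1 := Primrec.fst.comp (Primrec.snd.comp hq)
  have hc : Primrec fun x => (q x).2.2 + 1 :=
    Primrec.succ.comp (Primrec.snd.comp (Primrec.snd.comp hq))
  exact Primrec.nat_lt.comp
    (Primrec.nat_add.comp (Primrec.nat_add.comp
      (Primrec.nat_mul.comp (Primrec.nat_mul.comp (Primrec.nat_mul.comp hN hc) (two hs)) (two hn))
      (Primrec.nat_mul.comp (Primrec.nat_mul.comp (Primrec.nat_mul.comp ha (two hM)) (two hs)) (two hn)))
      (Primrec.nat_mul.comp (Primrec.nat_mul.comp hc (two hM)) (two hn)))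
    (Primrec.nat_add.comp
      (Primrec.nat_mul.comp (Primrec.nat_mul.comp hc (two hM)) (two hs))
      (Primrec.nat_mul.comp (Primrec.nat_mul.comp (Primrec.nat_mul.comp hb (two hM)) (two hs)) (two hn)))

/-! ### Filling up a Schnorr test -/

/-! A natural number `W` codes the data that justify listing a basic open set in the filled up
test. -/

namespace Witness

/-- `0` if a set of the given test is to be listed, positive if a filler is. -/
def tag (W : ℕ) : ℕ := W.unpair.1

/-- The number of computation steps. -/
def steps (W : ℕ) : ℕ := W.unpair.2.unpair.1

/-- The length of the initial segment of the oracle. -/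
def useLen (W : ℕ) : ℕ := W.unpair.2.unpair.2.unpair.1

/-- The stage of the given test. -/
def stage (W : ℕ) : ℕ := W.unpair.2.unpair.2.unpair.2.unpair.1

/-- The length of the filling strings. -/
def len (W : ℕ) : ℕ := W.unpair.2.unpair.2.unpair.2.unpair.2.unpair.1

/-- The number of filling strings. -/
def num (W : ℕ) : ℕ := W.unpair.2.unpair.2.unpair.2.unpair.2.unpair.2.unpair.1

/-- The index of the filling string to be listed. -/
def idx (W : ℕ) : ℕ := W.unpair.2.unpair.2.unpair.2.unpair.2.unpair.2.unpair.2

theorem primrec : Primrec tag ∧ Primrec steps ∧ Primrec useLen ∧ Primrec stage ∧ Primrec len ∧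
    Primrec num ∧ Primrec idx := by
  have hl : Primrec fun n : ℕ => n.unpair.1 := Primrec.fst.comp Primrec.unpair
  have hr : Primrec fun n : ℕ => n.unpair.2 := Primrec.snd.comp Primrec.unpair
  have h2 := hr.comp hr
  have h3 := hr.comp h2
  have h4 := hr.comp h3
  have h5 := hr.comp h4
  exact ⟨hl, hl.comp hr, hl.comp h2, hl.comp h3, hl.comp h4, hl.comp h5, hr.comp h5⟩

theorem exists_eq (g t k s M j i : ℕ) : ∃ W, tag W = g ∧ steps W = t ∧ useLen W = k ∧ stage W = s ∧
    len W = M ∧ num W = j ∧ idx W = i :=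
  ⟨Nat.pair g (Nat.pair t (Nat.pair k (Nat.pair s (Nat.pair M (Nat.pair j i))))),
    by simp [tag, steps, useLen, stage, len, num, idx]⟩

attribute [irreducible] tag steps useLen stage len num idx

end Witness

open Witness

/-- The basic open set listed for level `n` on account of `W`, given the list `L` of basic open
sets found so far and the value `r` of the given test at the stage of `W`. -/
def fillOut (n : ℕ) (W : ℕ) (L : List (Option (List Bool)))
    (r : Option (List Bool) × (ℕ × ℕ × ℕ)) : Option (List Bool) :=
  if tag W = 0 then r.1
  else if idx W < num W ∧ num W ≤ 2 ^ len W ∧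
      SmallEnough n (stage W) (len W) (missCount L (len W) (num W)) r.2 then
    some (digits (len W) (idx W))
  else none

theorem primrec_fillOut {α : Type} [Primcodable α] {n W : α → ℕ}
    {L : α → List (Option (List Bool))} {r : α → Option (List Bool) × (ℕ × ℕ × ℕ)}
    (hn : Primrec n) (hW : Primrec W) (hL : Primrec L) (hr : Primrec r) :
    Primrec fun x => fillOut (n x) (W x) (L x) (r x) := by
  obtain ⟨htag, -, -, hs, hM, hj, hi⟩ := Witness.primrec
  have hs' : Primrec fun x => stage (W x) := hs.comp hW
  have hM' : Primrec fun x => len (W x) := hM.comp hW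
  have hj' : Primrec fun x => num (W x) := hj.comp hW
  have hi' : Primrec fun x => idx (W x) := hi.comp hW
  have c0 : PrimrecPred fun x => tag (W x) = 0 := Primrec.eq.comp (htag.comp hW) (Primrec.const 0)
  have c1 : PrimrecPred fun x => idx (W x) < num (W x) := Primrec.nat_lt.comp hi' hj'
  have c2 : PrimrecPred fun x => num (W x) ≤ 2 ^ len (W x) :=
    Primrec.nat_le.comp hj' (primrec_pow.comp (Primrec.const 2) hM')
  have c3 := primrec_smallEnough hn hs' hM' (primrec_missCount hL hM' hj') (Primrec.snd.comp hr)
  have hd : Primrec fun x => some (digits (len (W x)) (idx (W x))) :=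
    Primrec.option_some.comp (primrec_digits.comp hM' hi')
  exact Primrec.ite c0 (Primrec.fst.comp hr)
    (Primrec.ite (c1.and (c2.and c3)) hd (Primrec.const none))

theorem computable_fillOut {α : Type} [Primcodable α] {n W : α → ℕ}
    {L : α → List (Option (List Bool))} {r : α → Option (List Bool) × (ℕ × ℕ × ℕ)}
    (hn : Computable n) (hW : Computable W) (hL : Computable L) (hr : Computable r) :
    Computable fun x => fillOut (n x) (W x) (L x) (r x) := by
  have h1 : Primrec fun q : ((ℕ × ℕ) × List (Option (List Bool))) ×
      (Option (List Bool) × (ℕ × ℕ × ℕ)) => fillOut q.1.1.1 q.1.1.2 q.1.2 q.2 :=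
    primrec_fillOut (Primrec.fst.comp (Primrec.fst.comp Primrec.fst))
      (Primrec.snd.comp (Primrec.fst.comp Primrec.fst)) (Primrec.snd.comp Primrec.fst) Primrec.snd
  have h2 := Computable.pair (Computable.pair (Computable.pair hn hW) hL) hr
  have h3 := h1.to_comp.comp h2
  exact h3.of_eq fun x => rfl

/-- The filled up test, computed from the approximation `ψ` to the given test. -/
def fill (ψ : (ℕ × List Bool) × (ℕ × ℕ) → Option (Option (List Bool) × (ℕ × ℕ × ℕ)))
    (τ : List Bool) (n : ℕ) (W : ℕ) : Option (List Bool) :=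
  -- A computation that has not halted yields `none`, so an answer exists for every oracle. Missing
  -- entries in the list count as `∅`, which can only increase `missCount` and is therefore safe.
  (ψ ((steps W, τ), (n, (stage W)))).bind fun r =>
    fillOut n W ((List.range (stage W)).map fun i => (ψ ((steps W, τ), (n, i))).bind Prod.fst) r

theorem computable_fill {ψ : (ℕ × List Bool) × (ℕ × ℕ) → Option (Option (List Bool) × (ℕ × ℕ × ℕ))}
    (hψ : Computable ψ) :
    Computable fun p : List Bool × (ℕ × ℕ) => fill ψ p.1 p.2.1 p.2.2 := by
  obtain ⟨-, ht, -, hs, -, -, -⟩ := Witness.primrec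
  have hw : Computable fun p : List Bool × (ℕ × ℕ) => p.2.2 :=
    Computable.snd.comp Computable.snd
  have hn : Computable fun p : List Bool × (ℕ × ℕ) => p.2.1 :=
    Computable.fst.comp Computable.snd
  have htτ : Computable fun p : List Bool × (ℕ × ℕ) => (steps p.2.2, p.1) :=
    Computable.pair (ht.to_comp.comp hw) Computable.fst
  have hL : Computable fun p : List Bool × (ℕ × ℕ) =>
      (List.range (stage p.2.2)).map fun i => (ψ ((steps p.2.2, p.1), (p.2.1, i))).bind Prod.fst := by
    refine computable_range_map (hs.to_comp.comp hw) ?_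
    refine Computable.option_bind (hψ.comp (Computable.pair (htτ.comp Computable.fst)
      (Computable.pair (hn.comp Computable.fst) Computable.snd))) ?_
    exact Computable.fst.comp Computable.snd
  refine Computable.option_bind (hψ.comp (Computable.pair htτ
    (Computable.pair hn (hs.to_comp.comp hw)))) ?_
  have h := computable_fillOut (α := (List Bool × (ℕ × ℕ)) × (Option (List Bool) × (ℕ × ℕ × ℕ)))
    (hn.comp Computable.fst) (hw.comp Computable.fst) (hL.comp Computable.fst) Computable.snd
  exact h

/-! ### Measure estimates for Schnorr tests and correctness of the filling. -/

theorem IsSchnorrTest.level_le_approx {c : TestCode} (hc : IsSchnorrTest c) (n s : ℕ) :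
    fairCoin.real (c.level n) ≤ c.approx n s + (1 / 2) ^ s := by
  obtain ⟨-, hq, hlim⟩ := hc n
  refine le_of_tendsto hlim ?_
  filter_upwards [eventually_ge_atTop s] with m hm
  have h := (abs_le.1 (hq s m hm)).2
  have h' : ((c.approx n m : ℚ) : ℝ) - c.approx n s ≤ (1 / 2) ^ s := by
    have := (Rat.cast_le (K := ℝ)).2 h
    push_cast at this
    exact this
  linarith

theorem IsSchnorrTest.approx_le_level {c : TestCode} (hc : IsSchnorrTest c) (n s : ℕ) :
    c.approx n s ≤ fairCoin.real (c.level n) + (1 / 2) ^ s := by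
  obtain ⟨-, hq, hlim⟩ := hc n
  refine le_of_tendsto_of_tendsto tendsto_const_nhds (hlim.add_const _) ?_
  filter_upwards [eventually_ge_atTop s] with m hm
  have h := (Rat.cast_le (K := ℝ)).2 (abs_le.1 (hq s m hm)).1
  push_cast at h
  linarith

theorem IsSchnorrTest.real_level_le {c : TestCode} (hc : IsSchnorrTest c) (n : ℕ) :
    fairCoin.real (c.level n) ≤ (1 / 2) ^ n := by
  have := ENNReal.toReal_mono (by simp) (hc n).1
  simpa [Measure.real] using this

theorem measurableSet_level (c : TestCode) (n : ℕ) : MeasurableSet (c.level n) :=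
  measurableSet_openOfCode _

/-- A positive outcome of the counting test bounds the measure of the filled up set. -/
theorem IsSchnorrTest.real_union_lt {c : TestCode} (hc : IsSchnorrTest c) {n s M j : ℕ}
    {L : List (Option (List Bool))} (hL : listUnion L ⊆ c.level n)
    (h : SmallEnough n s M (missCount L M j) (c (n, s)).2) :
    fairCoin.real (c.level n ∪ lowSet M j) < (1 / 2) ^ n := by
  rw [smallEnough_iff] at h
  have h1 : fairCoin.real (c.level n ∪ lowSet M j) ≤
      fairCoin.real (c.level n) + fairCoin.real (lowSet M j \ listUnion L) := by
    refine (measureReal_mono ?_).trans (measureReal_union_le _ _)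
    rintro X (hX | hX)
    · exact Or.inl hX
    · by_cases hXL : X ∈ listUnion L
      · exact Or.inl (hL hXL)
      · exact Or.inr ⟨hX, hXL⟩
  have h2 := fairCoin_lowSet_diff_le L M j
  have h3 := hc.level_le_approx n s
  rw [TestCode.approx] at h3
  linarith

theorem measurableSet_listUnion (L : List (Option (List Bool))) : MeasurableSet (listUnion L) := by
  have : listUnion L = ⋃ o ∈ {o | o ∈ L}, basicOpen o := by
    ext X; simp [listUnion]
  rw [this]
  exact MeasurableSet.biUnion (Set.to_countable _) fun o _ => measurableSet_basicOpen o

theorem tendsto_real_lowSet_diff (C : ℕ → Option (List Bool)) (M j : ℕ) :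
    Tendsto (fun s => fairCoin.real (lowSet M j \ listUnion ((List.range s).map C))) atTop
      (𝓝 (fairCoin.real (lowSet M j \ openOfCode C))) := by
  have hmono : Antitone fun s => lowSet M j \ listUnion ((List.range s).map C) := by
    intro s t hst X hX
    refine ⟨hX.1, fun h => hX.2 ?_⟩
    obtain ⟨o, ho, hX'⟩ := h
    obtain ⟨i, hi, rfl⟩ := List.mem_map.1 ho
    exact ⟨C i, List.mem_map.2 ⟨i, List.mem_range.2 ((List.mem_range.1 hi).trans_le hst), rfl⟩, hX'⟩
  have hinter : ⋂ s, (lowSet M j \ listUnion ((List.range s).map C)) = lowSet M j \ openOfCode C := by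
    ext X
    simp only [Set.mem_iInter, Set.mem_sdiff, openOfCode, Set.mem_iUnion, listUnion]
    constructor
    · intro h
      refine ⟨(h 0).1, ?_⟩
      rintro ⟨i, hi⟩
      exact (h (i + 1)).2 ⟨C i, List.mem_map.2 ⟨i, List.mem_range.2 (Nat.lt_succ_self i), rfl⟩, hi⟩
    · rintro ⟨hX, h⟩ s
      refine ⟨hX, ?_⟩
      rintro ⟨o, ho, hX'⟩
      obtain ⟨i, -, rfl⟩ := List.mem_map.1 ho
      exact h ⟨i, hX'⟩
  rw [← hinter]
  exact (ENNReal.tendsto_toReal (measure_ne_top _ _)).comp (tendsto_measure_iInter_atTop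
    (fun s => ((measurableSet_lowSet M j).diff (measurableSet_listUnion _)).nullMeasurableSet) hmono
    ⟨0, measure_ne_top _ _⟩)

/-- If filling up by an initial interval keeps the measure small, the counting test confirms it. -/
theorem IsSchnorrTest.exists_smallEnough {c : TestCode} (hc : IsSchnorrTest c) {n M₀ j₀ : ℕ}
    (h : fairCoin.real (c.level n ∪ lowSet M₀ j₀) < (1 / 2) ^ n) :
    ∃ s M j, lowSet M j = lowSet M₀ j₀ ∧ j ≤ 2 ^ M ∧
      SmallEnough n s M (missCount ((List.range s).map fun i => (c (n, i)).1) M j) (c (n, s)).2 := by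
  -- The left side of the tested inequality, with the exact measure in place of the count, tends to
  -- `μ (U ∪ I)`; hence some stage `s` brings it below the bound.
  have hlim : Tendsto (fun s => fairCoin.real
      (lowSet M₀ j₀ \ listUnion ((List.range s).map fun i => (c (n, i)).1)) + (c.approx n s : ℝ) +
        (1 / 2) ^ s) atTop (𝓝 (fairCoin.real (c.level n ∪ lowSet M₀ j₀))) := by
    have h1 := ((tendsto_real_lowSet_diff (fun i => (c (n, i)).1) M₀ j₀).add (hc n).2.2).add
      (tendsto_pow_atTop_nhds_zero_of_lt_one (show (0 : ℝ) ≤ 1 / 2 by norm_num) (by norm_num))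
    have h2 : fairCoin.real (c.level n ∪ lowSet M₀ j₀) =
        fairCoin.real (lowSet M₀ j₀ \ c.level n) + fairCoin.real (c.level n) := by
      rw [← Set.union_sdiff_self, measureReal_union Set.disjoint_sdiff_right
        ((measurableSet_lowSet _ _).diff (measurableSet_level c n)), add_comm]
    rw [h2]
    simpa [Measure.real, TestCode.level] using h1
  obtain ⟨s, hs⟩ := (hlim.eventually_lt_const h).exists
  set L := (List.range s).map fun i => (c (n, i)).1
  -- Refining the grid by `r` more digits makes it at least as fine as every string in `L`, so that
  -- the count becomes exact.
  obtain ⟨r, hr⟩ : ∃ r, ∀ ρ, some ρ ∈ L → ρ.length ≤ r := by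
    refine ⟨(L.map fun o => (o.getD []).length).sum, fun ρ hρ => ?_⟩
    exact List.single_le_sum (by simp) _ (List.mem_map.2 ⟨some ρ, hρ, rfl⟩)
  have hj₀ : j₀ ≤ 2 ^ M₀ := by
    by_contra hj
    rw [lowSet_eq_univ (by omega), Set.union_univ, probReal_univ] at h
    exact absurd h (not_lt.2 (pow_le_one₀ (by norm_num) (by norm_num)))
  have hj : 2 ^ r * j₀ ≤ 2 ^ (M₀ + r) := by
    rw [pow_add, mul_comm]
    exact Nat.mul_le_mul_right _ hj₀
  refine ⟨s, M₀ + r, 2 ^ r * j₀, lowSet_add _ _ _, hj, smallEnough_iff.2 ?_⟩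
  have h3 := missCount_le_fairCoin hj fun ρ hρ => (hr ρ hρ).trans (Nat.le_add_left r M₀)
  rw [lowSet_add] at h3
  rw [TestCode.approx] at hs
  linarith

/-- Soundness of `ψ` along `B` makes every positive counting test truthful. Completeness gives, for
each set or interval due to be listed, a single `W` whose resources suffice for all the finitely
many values involved. -/
theorem openOfCode_fill {c : TestCode} (hc : IsSchnorrTest c) {B : Cantor}
    {ψ : (ℕ × List Bool) × (ℕ × ℕ) → Option (Option (List Bool) × (ℕ × ℕ × ℕ))}
    (hsound : ∀ t k a v, ψ ((t, initSeg B k), a) = some v → v = c a)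
    (hcomplete : ∀ l : ℕ → ℕ × ℕ, ∀ s, ∃ t k, ∀ i < s, ψ ((t, initSeg B k), l i) = some (c (l i)))
    (n : ℕ) :
    openOfCode (fun W => fill ψ (initSeg B (useLen W)) n W) = c.level n ∪
      ⋃ p ∈ {p : ℕ × ℕ | fairCoin.real (c.level n ∪ lowSet p.1 p.2) < (1 / 2) ^ n},
        lowSet p.1 p.2 := by
  apply Set.Subset.antisymm
  · intro X hX
    obtain ⟨W, hX⟩ := Set.mem_iUnion.1 hX
    cases hr : ψ ((steps W, initSeg B (useLen W)), (n, stage W)) with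
    | none => simp only [fill, hr, Option.bind_none] at hX; exact hX.elim
    | some r =>
      obtain rfl := hsound _ _ _ _ hr
      simp only [fill, hr, Option.bind_some, fillOut] at hX
      split_ifs at hX with h1 h2
      · exact Or.inl (Set.mem_iUnion.2 ⟨stage W, hX⟩)
      · obtain ⟨hi, hj, hsm⟩ := h2
        rw [basicOpen_digits (hi.trans_le hj)] at hX
        refine Or.inr (Set.mem_biUnion (x := (len W, num W)) ?_ ?_)
        · change fairCoin.real (c.level n ∪ lowSet (len W) (num W)) < (1 / 2) ^ n
          refine hc.real_union_lt ?_ hsm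
          rintro Y ⟨o, ho, hY⟩
          obtain ⟨i, -, rfl⟩ := List.mem_map.1 ho
          cases hr' : ψ ((steps W, initSeg B (useLen W)), (n, i)) with
          | none => rw [hr'] at hY; exact hY.elim
          | some v =>
            obtain rfl := hsound _ _ _ _ hr'
            rw [hr'] at hY
            exact Set.mem_iUnion.2 ⟨i, hY⟩
        · exact lt_of_eq_of_lt hX hi
      · exact hX.elim
  · rintro X (hX | hX)
    · obtain ⟨s, hX⟩ := Set.mem_iUnion.1 hX
      obtain ⟨t, k, htk⟩ := hcomplete (fun i => (n, i)) (s + 1)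
      obtain ⟨W, h0, h1, h2, h3, -⟩ := Witness.exists_eq 0 t k s 0 0 0
      refine Set.mem_iUnion.2 ⟨W, ?_⟩
      have hr := htk s (Nat.lt_succ_self s)
      simpa [fill, fillOut, h0, h1, h2, h3, hr] using hX
    · obtain ⟨p, hp, hX⟩ := Set.mem_iUnion₂.1 hX
      obtain ⟨s, M, j, hMj, hj, hsm⟩ := hc.exists_smallEnough hp
      rw [← hMj] at hX
      obtain ⟨t, k, htk⟩ := hcomplete (fun i => (n, i)) (s + 1)
      obtain ⟨W, h0, h1, h2, h3, h4, h5, h6⟩ := Witness.exists_eq 1 t k s M j (binVal X M)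
      refine Set.mem_iUnion.2 ⟨W, ?_⟩
      have hr := htk s (Nat.lt_succ_self s)
      have hL : ((List.range s).map fun i => (ψ ((t, initSeg B k), (n, i))).bind Prod.fst) =
          (List.range s).map fun i => (c (n, i)).1 := by
        refine List.map_congr_left fun i hi => ?_
        rw [htk i ((List.mem_range.1 hi).trans (Nat.lt_succ_self s)), Option.bind_some]
      have hX : binVal X M < j := hX
      have : fill ψ (initSeg B (useLen W)) n W = some (digits M (binVal X M)) := by
        simp only [fill, fillOut, h0, h1, h2, h3, h4, h5, h6, hr, Option.bind_some, hL]
        rw [if_neg one_ne_zero, if_pos ⟨hX, hj, hsm⟩]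
      change X ∈ basicOpen (fill ψ (initSeg B (useLen W)) n W)
      rw [this, basicOpen_digits (hX.trans_le hj)]
      rfl

/-- Every Schnorr test computable in `B` is contained, level by level, in a test of measure
exactly `2 ^ (-n)` with codes truth-table reducible to `B`. -/
theorem exists_tt_fill {c : TestCode} {B : Cantor} (hcB : ComputableIn (oracle B) c)
    (hc : IsSchnorrTest c) :
    ∃ C : ℕ × ℕ → Option (List Bool), TTReducible C B ∧
      (∀ n, fairCoin (openOfCode fun s => C (n, s)) = (2⁻¹ : ℝ≥0∞) ^ n) ∧
      ∀ n, c.level n ⊆ openOfCode fun s => C (n, s) := by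
  obtain ⟨ψ, hψ, hsound, hcomplete⟩ := exists_stage_approx hcB
  refine ⟨fun a => fill ψ (initSeg B (useLen a.2)) a.1 a.2,
    -- The amount of oracle consulted is written in the index itself, hence computable in advance.
    ⟨fun X a => fill ψ (initSeg X (useLen a.2)) a.1 a.2, ?_, rfl⟩, fun n => ?_, fun n => ?_⟩
  · have hu : Computable fun a : ℕ × ℕ => useLen a.2 :=
      Computable.comp Witness.primrec.2.2.1.to_comp Computable.snd
    exact totalComputableFunctional_of_use (F := fun τ (a : ℕ × ℕ) => fill ψ τ a.1 a.2)
      (computable_fill hψ) hu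
  · have h := fairCoin_fill (hc.real_level_le n) (pow_le_one₀ (by norm_num) (by norm_num))
    rw [← openOfCode_fill hc hsound hcomplete n] at h
    rw [← ofReal_measureReal, h, ENNReal.ofReal_pow (by norm_num)]
    congr 1
    rw [one_div, ENNReal.ofReal_inv_of_pos (by norm_num)]
    simp
  · simp only [openOfCode_fill hc hsound hcomplete n]
    exact Set.subset_union_left

/-! ### The equivalence of the two nonuniform notions. -/

theorem TTReducible.prodMk {α σ τ : Type} [Primcodable α] [Primcodable σ] [Primcodable τ]
    {f : α → σ} {g : α → τ} {B : Cantor} (hf : TTReducible f B) (hg : Computable g) :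
    TTReducible (fun a => (f a, g a)) B := by
  obtain ⟨Φ, ⟨φ, hφ, hΦ⟩, rfl⟩ := hf
  refine ⟨fun X a => (Φ X a, g a), ⟨fun τ a => (φ τ a).map fun v => (v, g a), ?_, fun X a => ⟨?_, ?_⟩⟩,
    rfl⟩
  · refine Computable.option_map hφ ?_
    exact Computable.pair Computable.snd (hg.comp (Computable.snd.comp Computable.fst))
  · obtain ⟨k, hk⟩ := (hΦ X a).1
    exact ⟨k, by simp [hk]⟩
  · intro k v hv
    obtain ⟨w, hw, rfl⟩ := Option.map_eq_some_iff.1 hv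
    rw [(hΦ X a).2 k w hw]

theorem ttTest_iff_schnorr (A B : Cantor) :
    TTTestSchnorrRandomRelativeTo A B ↔ SchnorrRandomRelativeTo A B := by
  refine not_congr ⟨?_, ?_⟩
  · rintro ⟨C, hC, hμ, hA⟩
    -- Names `(1 - 0) / ((2 ^ n - 1) + 1)`, the exact measure of the `n`-th set.
    let g : ℕ × ℕ → ℕ × ℕ × ℕ := fun a => (1, 0, 2 ^ a.1 - 1)
    have hg : Computable g := by
      refine Primrec.to_comp (Primrec.pair (Primrec.const 1) (Primrec.pair (Primrec.const 0) ?_))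
      exact Primrec.nat_sub.comp (primrec_pow.comp (Primrec.const 2) Primrec.fst) (Primrec.const 1)
    have hrat : ∀ n s, ratOfCode (g (n, s)) = (1 / 2) ^ n := by
      intro n s
      have h1 : 1 ≤ 2 ^ n := Nat.one_le_two_pow
      simp [g, ratOfCode, Nat.cast_sub h1]
    refine ⟨fun a => (C a, g a), (hC.prodMk hg).computableIn, fun n => ⟨(hμ n).le, ?_, ?_⟩, hA⟩
    · intro k m _
      simp only [TestCode.approx, hrat, sub_self, abs_zero]
      positivity
    · have h : (fairCoin (TestCode.level (fun a => (C a, g a)) n)).toReal = (1 / 2) ^ n := by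
        rw [show fairCoin (TestCode.level (fun a => (C a, g a)) n) = _ from hμ n]
        simp
      rw [h]
      simp only [TestCode.approx, hrat]
      push_cast
      exact tendsto_const_nhds
  · rintro ⟨c, hcB, hc, hA⟩
    obtain ⟨C, hC, hμ, hsub⟩ := exists_tt_fill hcB hc
    exact ⟨C, hC, hμ, fun n => hsub n (hA n)⟩

/-! ### Upper semicontinuity of uniform tests -/

theorem TotalComputableFunctional.locally_constant {α σ : Type} [Primcodable α] [Primcodable σ]
    {Φ : Cantor → α → σ} (hΦ : TotalComputableFunctional Φ) (X : Cantor) (a : α) :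
    ∃ k, ∀ Y ∈ cyl X k, Φ Y a = Φ X a := by
  obtain ⟨φ, -, h⟩ := hΦ
  obtain ⟨k, hk⟩ := (h X a).1
  refine ⟨k, fun Y hY => ((h Y a).2 k _ ?_).symm⟩
  rw [initSeg_eq_iff.2 hY, hk]

/-- `W Y` is, up to small measure, contained in `W X` when `Y` is close to `X`. -/
def UpperSemicont (W : Cantor → Set Cantor) : Prop :=
  ∀ X, ∀ ε > 0, ∃ k, ∀ Y ∈ cyl X k, fairCoin.real (W Y \ W X) ≤ ε

theorem UpperSemicont.union {V W : Cantor → Set Cantor} (hV : UpperSemicont V)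
    (hW : UpperSemicont W) : UpperSemicont fun X => V X ∪ W X := by
  intro X ε hε
  obtain ⟨k, hk⟩ := hV X (ε / 2) (half_pos hε)
  obtain ⟨l, hl⟩ := hW X (ε / 2) (half_pos hε)
  refine ⟨max k l, fun Y hY => ?_⟩
  have h1 := hk Y (cyl_anti X (le_max_left _ _) hY)
  have h2 := hl Y (cyl_anti X (le_max_right _ _) hY)
  have hsub : (V Y ∪ W Y) \ (V X ∪ W X) ⊆ (V Y \ V X) ∪ (W Y \ W X) := by
    rintro Z ⟨hZ | hZ, hn⟩
    · exact Or.inl ⟨hZ, fun h => hn (Or.inl h)⟩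
    · exact Or.inr ⟨hZ, fun h => hn (Or.inr h)⟩
  have h3 := (measureReal_mono (μ := fairCoin) hsub).trans (measureReal_union_le _ _)
  linarith

/-- A finite part `D` carrying almost all of the measure at `X`, and a precise rational
approximation, are both unchanged for `Y` near `X`. Since `Φ Y` is again a test, that rational
bounds the measure of its level, leaving little room outside `D`. -/
theorem IsUniformSchnorrTest.upperSemicont {Φ : Cantor → TestCode} (hΦ : IsUniformSchnorrTest Φ)
    (n : ℕ) : UpperSemicont fun X => (Φ X).level n := by
  intro X ε hε
  obtain ⟨s, hs⟩ := exists_pow_lt_of_lt_one (show 0 < ε / 3 by positivity)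
    (show (1 / 2 : ℝ) < 1 by norm_num)
  have huniv : lowSet 0 1 = Set.univ := lowSet_eq_univ (by simp)
  obtain ⟨m, hm⟩ : ∃ m, fairCoin.real ((Φ X).level n) ≤
      fairCoin.real (listUnion ((List.range m).map fun i => (Φ X (n, i)).1)) + ε / 3 := by
    have hlim := tendsto_real_lowSet_diff (fun i => (Φ X (n, i)).1) 0 1
    obtain ⟨m, hm⟩ := (hlim.eventually_lt_const (lt_add_of_pos_right _ (show 0 < ε / 3 by positivity))).exists
    refine ⟨m, ?_⟩
    rw [huniv, ← Set.compl_eq_univ_sdiff, ← Set.compl_eq_univ_sdiff,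
      probReal_compl_eq_one_sub (measurableSet_listUnion _),
      probReal_compl_eq_one_sub (measurableSet_openOfCode _)] at hm
    change fairCoin.real (openOfCode fun i => (Φ X (n, i)).1) ≤ _
    linarith
  -- The values below `max m (s + 1)` include the `m` sets making up `D` and the `s`-th rational.
  obtain ⟨k, hk⟩ := exists_stage_forall_lt
    (P := fun i k => ∀ Y ∈ cyl X k, Φ Y (n, i) = Φ X (n, i)) (n := max m (s + 1))
    (fun hk h Y hY => h Y (cyl_anti X hk hY)) (fun i _ => hΦ.1.locally_constant X (n, i))
  refine ⟨k, fun Y hY => ?_⟩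
  set D := listUnion ((List.range m).map fun i => (Φ X (n, i)).1) with hD
  have hDX : D ⊆ (Φ X).level n := by
    rintro Z ⟨o, ho, hZ⟩
    obtain ⟨i, -, rfl⟩ := List.mem_map.1 ho
    exact Set.mem_iUnion.2 ⟨i, hZ⟩
  have hDY : D ⊆ (Φ Y).level n := by
    rintro Z ⟨o, ho, hZ⟩
    obtain ⟨i, hi, rfl⟩ := List.mem_map.1 ho
    rw [← hk i ((List.mem_range.1 hi).trans_le (le_max_left _ _)) Y hY] at hZ
    exact Set.mem_iUnion.2 ⟨i, hZ⟩
  have h1 : fairCoin.real ((Φ Y).level n \ (Φ X).level n) ≤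
      fairCoin.real ((Φ Y).level n) - fairCoin.real D := by
    rw [← measureReal_sdiff hDY (measurableSet_listUnion _)]
    exact measureReal_mono (Set.sdiff_subset_sdiff_right hDX)
  have h2 := (hΦ.2 Y).level_le_approx n s
  have h3 := (hΦ.2 X).approx_le_level n s
  have h4 : (Φ Y).approx n s = (Φ X).approx n s := by
    rw [TestCode.approx, TestCode.approx,
      hk s ((Nat.lt_succ_self s).trans_le (le_max_right _ _)) Y hY]
  rw [h4] at h2
  linarith

theorem UpperSemicont.exists_pos {W : Cantor → Set Cantor} (hW : UpperSemicont W) {P : Set Cantor}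
    {X : Cantor} (h : 0 < fairCoin.real (P \ W X)) :
    ∃ k, ∀ Y ∈ cyl X k, 0 < fairCoin.real (P \ W Y) := by
  obtain ⟨k, hk⟩ := hW X _ (half_pos h)
  refine ⟨k, fun Y hY => ?_⟩
  have hsub : P \ W X ⊆ (P \ W Y) ∪ (W Y \ W X) := by
    rintro Z ⟨hZ, hn⟩
    by_cases hZY : Z ∈ W Y
    · exact Or.inr ⟨hZY, hn⟩
    · exact Or.inl ⟨hZ, hZY⟩
  have h1 := (measureReal_mono (μ := fairCoin) hsub).trans (measureReal_union_le _ _)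
  have h2 := hk Y hY
  linarith

/-! ### Blocks of zeros in sets of positive measure -/

theorem cyl_eq_union (X : Cantor) (k : ℕ) :
    cyl X k ⊆ cyl X (k + 1) ∪ cyl (Function.update X k (!X k)) (k + 1) := by
  intro Y hY
  by_cases h : Y k = X k
  · refine Or.inl fun i hi => ?_
    rcases Nat.lt_succ_iff_lt_or_eq.1 hi with hi | rfl
    · exact hY i hi
    · exact h
  · refine Or.inr fun i hi => ?_
    rcases Nat.lt_succ_iff_lt_or_eq.1 hi with hi | rfl
    · rw [Function.update_of_ne hi.ne, hY i hi]
    · rw [Function.update_self]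
      exact Bool.eq_not.2 h

/-- A set that meets a cylinder in positive measure meets in positive measure some
subcylinder that ends with `r` zeros. -/
theorem exists_zero_block {P : Set Cantor} {a : Cantor} {l : ℕ}
    (h : 0 < fairCoin.real (P ∩ cyl a l)) (r : ℕ) :
    ∃ b ∈ cyl a l, ∃ m, l ≤ m ∧ (∀ i, m ≤ i → b i = false) ∧
      0 < fairCoin.real (P ∩ cyl b (m + r)) := by
  -- The density of `P` in a cylinder. A subcylinder of nearly maximal density plays the role of a
  -- Lebesgue density point.
  let f : Cantor × ℕ → ℝ := fun p => 2 ^ p.2 * fairCoin.real (P ∩ cyl p.1 p.2)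
  let E : Set (Cantor × ℕ) := {p | p.1 ∈ cyl a l ∧ l ≤ p.2}
  have hbdd : BddAbove (f '' E) := by
    refine ⟨1, ?_⟩
    rintro _ ⟨p, -, rfl⟩
    have h1 : fairCoin.real (P ∩ cyl p.1 p.2) ≤ (1 / 2) ^ p.2 :=
      (measureReal_mono Set.inter_subset_right).trans (fairCoin_real_cyl _ _).le
    calc f p ≤ 2 ^ p.2 * (1 / 2) ^ p.2 := mul_le_mul_of_nonneg_left h1 (by positivity)
      _ = 1 := by rw [← mul_pow]; norm_num
  have hmem : f (a, l) ∈ f '' E := ⟨(a, l), ⟨mem_cyl_self a l, le_rfl⟩, rfl⟩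
  set θ := sSup (f '' E) with hθ
  have hle : ∀ p ∈ E, f p ≤ θ := fun p hp => le_csSup hbdd ⟨p, hp, rfl⟩
  have hθpos : 0 < θ := lt_of_lt_of_le (by simp only [f]; positivity) (hle (a, l) ⟨mem_cyl_self a l, le_rfl⟩)
  have hlt : θ - θ / 2 ^ r < θ := sub_lt_self _ (by positivity)
  obtain ⟨_, ⟨⟨b₀, m⟩, ⟨hb₀, hm⟩, rfl⟩, hfb⟩ := exists_lt_of_lt_csSup ⟨_, hmem⟩ hlt
  let b : Cantor := fun i => if i < m then b₀ i else false
  have hb : b ∈ cyl b₀ m := fun i hi => by simp [b, hi]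
  have hba : b ∈ cyl a l := fun i hi => (hb i (hi.trans_le hm)).trans (hb₀ i hi)
  have hbm : f (b, m) = f (b₀, m) := by simp only [f, cyl_eq_of_mem hb]
  -- The density of a cylinder is the mean of those of its halves, and the sibling has density at
  -- most `θ`. So each further zero at most doubles the deficit, which starts below `θ / 2 ^ r` and
  -- stays below `θ` for `r` steps.
  have hstep : ∀ q, θ - f (b, m + q) ≤ 2 ^ q * (θ - f (b, m)) := by
    intro q
    induction q with
    | zero => simp
    | succ q ih =>
      set b' := Function.update b (m + q) (!b (m + q)) with hb'
      have hb'E : (b', m + q + 1) ∈ E := by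
        refine ⟨fun i hi => ?_, ?_⟩
        · change b' i = a i
          rw [hb', Function.update_of_ne (by omega), hba i hi]
        · change l ≤ m + q + 1
          omega
      have h1 : fairCoin.real (P ∩ cyl b (m + q)) ≤
          fairCoin.real (P ∩ cyl b (m + q + 1)) + fairCoin.real (P ∩ cyl b' (m + q + 1)) := by
        refine (measureReal_mono ?_).trans (measureReal_union_le _ _)
        rw [← Set.inter_union_distrib_left]
        exact Set.inter_subset_inter_right _ (cyl_eq_union _ _)
      have h2 : 2 * f (b, m + q) ≤ f (b, m + q + 1) + f (b', m + q + 1) := by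
        simp only [f, ← mul_add]
        rw [pow_succ', mul_assoc]
        gcongr
      have h3 := hle _ hb'E
      rw [pow_succ', ← add_assoc]
      linarith
  have hfin : 0 < f (b, m + r) := by
    have h1 := hstep r
    have h2 : 2 ^ r * (θ - f (b, m)) < 2 ^ r * (θ / 2 ^ r) := by
      gcongr
      rw [hbm]; linarith
    rw [mul_div_cancel₀ _ (by positivity)] at h2
    linarith
  refine ⟨b, hba, m, hm, fun i hi => by simp [b, hi], ?_⟩
  exact pos_of_mul_pos_right hfin (by positivity)

/-! ### Limits of nested cylinders and countability -/

theorem exists_limit {x : ℕ → Cantor} {l : ℕ → ℕ} (hl : StrictMono l)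
    (hx : ∀ s, x (s + 1) ∈ cyl (x s) (l s)) : ∃ Z, ∀ s, Z ∈ cyl (x s) (l s) := by
  have hmem : ∀ s d, x (s + d) ∈ cyl (x s) (l s) := by
    intro s d
    induction d with
    | zero => exact mem_cyl_self _ _
    | succ d ih =>
      intro i hi
      rw [← add_assoc, hx (s + d) i (hi.trans_le (hl.monotone (Nat.le_add_right s d))), ih i hi]
  -- Digit `i` is settled by stage `i + 1`, since `l (i + 1) ≥ i + 1`.
  refine ⟨fun i => x (i + 1) i, fun s i hi => ?_⟩
  have h1 := hmem (i + 1) s i ((Nat.lt_succ_self i).trans_le (hl.id_le (i + 1)))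
  have h2 := hmem s (i + 1) i hi
  rw [add_comm (i + 1) s] at h1
  exact h1.symm.trans h2

theorem countable_computable {α σ : Type} [Primcodable α] [Primcodable σ] :
    {f : α → σ | Computable f}.Countable := by
  have hcode : ∀ f : α → σ, Computable f → ∃ e : Nat.Partrec.Code,
      ∀ a, e.eval (Encodable.encode a) = Part.some (Encodable.encode (f a)) := by
    intro f hf
    obtain ⟨e, he⟩ := Nat.Partrec.Code.exists_code.1 (show Nat.Partrec _ from hf)
    exact ⟨e, fun a => by rw [he]; simp⟩
  have hsub : {f : α → σ | Computable f} ⊆ ⋃ e : Nat.Partrec.Code,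
      {f | ∀ a, e.eval (Encodable.encode a) = Part.some (Encodable.encode (f a))} :=
    fun f hf => Set.mem_iUnion.2 (hcode f hf)
  refine Set.Countable.mono hsub (Set.countable_iUnion fun e => Set.Subsingleton.countable ?_)
  intro f hf g hg
  funext a
  exact Encodable.encode_injective (Part.some_injective ((hf a).symm.trans (hg a)))

theorem countable_totalComputableFunctional {α σ : Type} [Primcodable α] [Primcodable σ] :
    {Φ : Cantor → α → σ | TotalComputableFunctional Φ}.Countable := by
  have hsub : {Φ : Cantor → α → σ | TotalComputableFunctional Φ} ⊆
      ⋃ φ ∈ {φ : List Bool × α → Option σ | Computable φ},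
        {Φ | ∀ (X : Cantor) (a : α), (∃ k, φ (initSeg X k, a) = some (Φ X a)) ∧
          ∀ k v, φ (initSeg X k, a) = some v → v = Φ X a} := by
    rintro Φ ⟨φ, hφ, h⟩
    exact Set.mem_biUnion (x := fun p : List Bool × α => φ p.1 p.2) hφ h
  refine Set.Countable.mono hsub (countable_computable.biUnion fun φ _ =>
    Set.Subsingleton.countable ?_)
  intro Φ hΦ Ψ hΨ
  funext X a
  obtain ⟨k, hk⟩ := (hΦ X a).1
  exact (hΨ X a).2 k _ hk

/-! ### The separation -/

/-- A condition in the finite extension argument: the cylinders `cyl a l` and `cyl X k` approximate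
the two sequences `A` and `B` under construction, and `W` is the union of the test levels that `A`
has to avoid. -/
structure Stage where
  a : Cantor
  l : ℕ
  X : Cantor
  k : ℕ
  W : Cantor → Set Cantor
  usc : UpperSemicont W
  pos : ∀ Y ∈ cyl X k, 0 < fairCoin.real (cyl a l \ W Y)

/-- `T` extends `S`, takes care of the test `Φ`, puts `s` zeros at position `m` of `A`, and
puts the code of `s` and `m` into `B`. -/
structure Stage.Extends (Φ : Cantor → TestCode) (s : ℕ) (S T : Stage) (m j : ℕ) : Prop where
  l_lt : S.l < T.l
  a_mem : T.a ∈ cyl S.a S.l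
  W_subset : ∀ Y, S.W Y ⊆ T.W Y
  test : IsUniformSchnorrTest Φ → ∃ n, ∀ Y, (Φ Y).level n ⊆ T.W Y
  le_code : S.k ≤ Nat.pair s (Nat.pair m j)
  code_lt : Nat.pair s (Nat.pair m j) < T.k
  X_eq : T.X = Function.update S.X (Nat.pair s (Nat.pair m j)) true
  block_le : m + s ≤ T.l
  zeros : ∀ i, m ≤ i → i < m + s → T.a i = false

/-- A level smaller than the measure still available at `S.X` can be added to the forbidden set. If
`Φ` is not a uniform test, nothing is added. -/
theorem Stage.exists_cover (S : Stage) (Φ : Cantor → TestCode) :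
    ∃ V : Cantor → Set Cantor, UpperSemicont V ∧ (∀ Y, S.W Y ⊆ V Y) ∧
      (IsUniformSchnorrTest Φ → ∃ n, ∀ Y, (Φ Y).level n ⊆ V Y) ∧
      0 < fairCoin.real (cyl S.a S.l \ V S.X) := by
  have hpos := S.pos S.X (mem_cyl_self _ _)
  by_cases hΦ : IsUniformSchnorrTest Φ
  · obtain ⟨n, hn⟩ := exists_pow_lt_of_lt_one hpos (show (1 / 2 : ℝ) < 1 by norm_num)
    refine ⟨fun Y => S.W Y ∪ (Φ Y).level n, S.usc.union (hΦ.upperSemicont n),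
      fun Y => Set.subset_union_left, fun _ => ⟨n, fun Y => Set.subset_union_right⟩, ?_⟩
    have hsub : cyl S.a S.l \ S.W S.X ⊆
        (cyl S.a S.l \ (S.W S.X ∪ (Φ S.X).level n)) ∪ (Φ S.X).level n := by
      rintro Z ⟨hZ, hW⟩
      by_cases h : Z ∈ (Φ S.X).level n
      · exact Or.inr h
      · exact Or.inl ⟨hZ, fun h' => h'.elim hW h⟩
    have h1 := (measureReal_mono (μ := fairCoin) hsub).trans (measureReal_union_le _ _)
    have h2 := (hΦ.2 S.X).real_level_le n
    linarith
  · exact ⟨S.W, S.usc, fun _ => subset_rfl, fun h => absurd h hΦ, hpos⟩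

/-- The order of choices is decisive. The position `m` is found for the oracle `S.X`; semicontinuity
then yields a length `k` protecting the positive measure for all oracles agreeing with `S.X` below
`k`; the code of `m` goes beyond `k`. The entry `j` is mere padding that makes the code large. -/
theorem Stage.exists_extends (Φ : Cantor → TestCode) (s : ℕ) (S : Stage) :
    ∃ T : Stage, ∃ m j, S.Extends Φ s T m j := by
  obtain ⟨V, husc, hsub, htest, hpos⟩ := S.exists_cover Φ
  rw [Set.sdiff_eq, Set.inter_comm] at hpos
  -- One zero more than needed, so that the length grows strictly even for `s = 0`.
  obtain ⟨b, hb, m, hm, hzero, hpos⟩ := exists_zero_block hpos (s + 1)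
  rw [Set.inter_comm, ← Set.sdiff_eq] at hpos
  obtain ⟨k, hk⟩ := husc.exists_pos hpos
  have hj : max S.k k ≤ Nat.pair s (Nat.pair m (max S.k k)) :=
    (Nat.right_le_pair _ _).trans (Nat.right_le_pair _ _)
  refine ⟨⟨b, m + (s + 1), Function.update S.X (Nat.pair s (Nat.pair m (max S.k k))) true,
    Nat.pair s (Nat.pair m (max S.k k)) + 1, V, husc, fun Y hY => hk Y fun i hi => ?_⟩, m, max S.k k,
    ⟨?_, hb, hsub, htest, (le_max_left _ _).trans hj, Nat.lt_succ_self _, rfl, ?_,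
      fun i hi _ => hzero i hi⟩⟩
  · have hi' : i < Nat.pair s (Nat.pair m (max S.k k)) :=
      hi.trans_le ((le_max_right _ _).trans hj)
    rw [hY i (hi'.trans (Nat.lt_succ_self _)), Function.update_of_ne hi'.ne]
  · change S.l < m + (s + 1)
    omega
  · change m + s ≤ m + (s + 1)
    omega

/-- The condition that imposes nothing. -/
def Stage.start : Stage where
  a := fun _ => false
  l := 0
  X := fun _ => false
  k := 0
  W := fun _ => ∅
  usc := fun _ ε hε => ⟨0, fun _ _ => by simpa using hε.le⟩
  pos := fun Y _ => by
    rw [Set.sdiff_empty, fairCoin_real_cyl]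
    norm_num

theorem exists_stages (Φ : ℕ → Cantor → TestCode) : ∃ (S : ℕ → Stage) (m j : ℕ → ℕ),
    S 0 = Stage.start ∧ ∀ s, (S s).Extends (Φ s) s (S (s + 1)) (m s) (j s) := by
  choose T m j h using fun s S => Stage.exists_extends (Φ s) s S
  let S : ℕ → Stage := fun s => Nat.rec Stage.start T s
  exact ⟨S, fun s => m s (S s), fun s => j s (S s), rfl, fun s => h s (S s)⟩

/-- The listing, computed from an initial segment `τ` of an oracle, of the sets of all
sequences with `n` zeros at a position `m` such that the oracle contains a code of `n` and `m`. -/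
def blockTest (τ : List Bool) (p : ℕ × ℕ) : Option (List Bool) :=
  -- The index splits into a candidate `Nat.pair m j` and a number `i` running through all prefixes
  -- of length `m`; `digits p.1 0` is the block of zeros.
  if τ[Nat.pair p.1 p.2.unpair.1]? = some true then
    some (digits p.2.unpair.1.unpair.1 p.2.unpair.2 ++ digits p.1 0)
  else none

theorem computable_blockTest : Computable₂ blockTest := by
  have hw : Primrec fun q : List Bool × (ℕ × ℕ) => q.2.2.unpair :=
    Primrec.unpair.comp (Primrec.snd.comp Primrec.snd)
  have hn : Primrec fun q : List Bool × (ℕ × ℕ) => q.2.1 := Primrec.fst.comp Primrec.snd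
  have hm : Primrec fun q : List Bool × (ℕ × ℕ) => q.2.2.unpair.1.unpair.1 :=
    Primrec.fst.comp (Primrec.unpair.comp (Primrec.fst.comp hw))
  have hc : PrimrecPred fun q : List Bool × (ℕ × ℕ) =>
      q.1[Nat.pair q.2.1 q.2.2.unpair.1]? = some true :=
    Primrec.eq.comp (Primrec.list_getElem?.comp Primrec.fst
      (Primrec₂.natPair.comp hn (Primrec.fst.comp hw))) (Primrec.const _)
  exact (Primrec.ite hc (Primrec.option_some.comp (Primrec.list_append.comp
    (primrec_digits.comp hm (Primrec.snd.comp hw))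
    (primrec_digits.comp hn (Primrec.const 0)))) (Primrec.const none)).to_comp

theorem mem_basicOpen_digits_append {Z : Cantor} {m i n : ℕ} :
    Z ∈ basicOpen (some (digits m i ++ digits n 0)) ↔
      initSeg Z m = digits m i ∧ ∀ q < n, Z (m + q) = false := by
  change initSeg Z (digits m i ++ digits n 0).length = _ ↔ _
  have h1 : initSeg Z (m + n) = initSeg Z m ++ (List.range n).map fun q => Z (m + q) := by
    simp [initSeg, List.range_add, Function.comp_def]
  have h2 : digits n 0 = (List.range n).map fun _ => false := by simp [digits]
  rw [List.length_append, digits_length, digits_length, h1, h2]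
  constructor
  · intro h
    obtain ⟨h3, h4⟩ := List.append_inj h (by rw [initSeg_length, digits_length])
    exact ⟨h3, fun q hq => List.map_inj_left.1 h4 q (List.mem_range.2 hq)⟩
  · rintro ⟨h3, h4⟩
    rw [h3, List.map_congr_left fun q hq => h4 q (List.mem_range.1 hq)]

theorem openOfCode_blockTest {B : Cantor} {n m j : ℕ}
    (hB : ∀ x, B (Nat.pair n x) = true ↔ x = Nat.pair m j) :
    openOfCode (fun w => blockTest (initSeg B (Nat.pair n w.unpair.1 + 1)) (n, w)) =
      {Z | ∀ i ∈ Finset.Ico m (m + n), Z i = false} := by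
  have hval : ∀ w, blockTest (initSeg B (Nat.pair n w.unpair.1 + 1)) (n, w) =
      if w.unpair.1 = Nat.pair m j then
        some (digits w.unpair.1.unpair.1 w.unpair.2 ++ digits n 0) else none := by
    intro w
    simp only [blockTest, initSeg_getElem? B (Nat.lt_succ_self _), Option.some.injEq, hB]
  ext Z
  simp only [openOfCode, Set.mem_iUnion, hval]
  constructor
  · rintro ⟨w, hw⟩
    split_ifs at hw with h
    · rw [h, Nat.unpair_pair, mem_basicOpen_digits_append] at hw
      intro i hi
      obtain ⟨h1, h2⟩ := Finset.mem_Ico.1 hi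
      have := hw.2 (i - m) (by omega)
      rwa [Nat.add_sub_cancel' h1] at this
    · exact hw.elim
  · intro hZ
    refine ⟨Nat.pair (Nat.pair m j) (binVal Z m), ?_⟩
    rw [Nat.unpair_pair, if_pos rfl, Nat.unpair_pair, mem_basicOpen_digits_append]
    exact ⟨initSeg_eq_digits Z m, fun q hq => hZ (m + q) (Finset.mem_Ico.2 ⟨by omega, by omega⟩)⟩

/-- Each column of `B` holds exactly one code, which gives level `n` measure exactly `2 ^ (-n)`. For
oracles with no code or several codes in a column the measure may differ; this is harmless here but
would spoil a uniform test. -/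
theorem not_ttTest_of_blocks {A B : Cantor} {m j : ℕ → ℕ}
    (hB : ∀ n x, B (Nat.pair n x) = true ↔ x = Nat.pair (m n) (j n))
    (hA : ∀ n, ∀ i ∈ Finset.Ico (m n) (m n + n), A i = false) :
    ¬ TTTestSchnorrRandomRelativeTo A B := by
  refine not_not.2 ⟨fun p => blockTest (initSeg B (Nat.pair p.1 p.2.unpair.1 + 1)) p,
    ⟨fun X p => blockTest (initSeg X (Nat.pair p.1 p.2.unpair.1 + 1)) p, ?_, rfl⟩,
    fun n => ?_, fun n => ?_⟩
  · refine totalComputableFunctional_of_use (κ := fun p : ℕ × ℕ => Nat.pair p.1 p.2.unpair.1 + 1)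
      computable_blockTest (Primrec.to_comp ?_)
    exact Primrec.succ.comp (Primrec₂.natPair.comp Primrec.fst
      (Primrec.fst.comp (Primrec.unpair.comp Primrec.snd)))
  · rw [openOfCode_blockTest (hB n)]
    have := fairCoin_box (Finset.Ico (m n) (m n + n)) fun _ => false
    simpa using this
  · rw [openOfCode_blockTest (hB n)]
    exact hA n

theorem exists_uniform_not_ttTest : ∃ A B : Cantor, SchnorrRandomUniformlyRelativeTo A B ∧
    ¬ TTTestSchnorrRandomRelativeTo A B := by
  -- The enumeration only has to include all total computable functionals; stages for other members
  -- add no requirement.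
  obtain ⟨Φ, hΦ⟩ := (Set.countable_iff_exists_subset_range).1
    (countable_totalComputableFunctional (α := ℕ × ℕ) (σ := Option (List Bool) × (ℕ × ℕ × ℕ)))
  obtain ⟨S, m, j, h0, hS⟩ := exists_stages Φ
  have hl : StrictMono fun s => (S s).l := strictMono_nat_of_lt_succ fun s => (hS s).l_lt
  have hk : StrictMono fun s => (S s).k :=
    strictMono_nat_of_lt_succ fun s => (hS s).le_code.trans_lt (hS s).code_lt
  have hW : ∀ Y, Monotone fun s => (S s).W Y :=
    fun Y => monotone_nat_of_le_succ fun s => (hS s).W_subset Y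
  obtain ⟨A, hA⟩ := exists_limit hl fun s => (hS s).a_mem
  obtain ⟨B, hB⟩ := exists_limit (x := fun s => (S s).X) hk fun s i hi => by
    rw [(hS s).X_eq, Function.update_of_ne (hi.trans_le (hS s).le_code).ne]
  have hX : ∀ s i, (S s).X i = true → ∃ t, i = Nat.pair t (Nat.pair (m t) (j t)) := by
    intro s
    induction s with
    | zero => intro i hi; rw [h0] at hi; exact absurd hi Bool.false_ne_true
    | succ s ih =>
      intro i hi
      by_cases h : i = Nat.pair s (Nat.pair (m s) (j s))
      · exact ⟨s, h⟩
      · rw [(hS s).X_eq, Function.update_of_ne h] at hi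
        exact ih i hi
  refine ⟨A, B, ?_, not_ttTest_of_blocks (m := m) (j := j) (fun n x => ⟨fun h => ?_, ?_⟩) ?_⟩
  · rintro ⟨Ψ, hΨ, hAΨ⟩
    obtain ⟨e, rfl⟩ := hΦ hΨ.1
    obtain ⟨n, hn⟩ := (hS e).test hΨ
    -- If `A` lay in the open level, so would a whole cylinder around `A`. From stage `max (e + 1)
    -- q` on, the cylinder of the condition would be swallowed by the forbidden set at `B`,
    -- contradicting positivity.
    obtain ⟨q, hq⟩ := exists_cyl_subset_of_mem_openOfCode (hAΨ n)
    have hpos := (S (max (e + 1) q)).pos B (hB _)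
    have hsub : cyl (S (max (e + 1) q)).a (S (max (e + 1) q)).l ⊆ (S (max (e + 1) q)).W B := by
      rw [← cyl_eq_of_mem (hA _)]
      refine (cyl_anti A ((le_max_right (e + 1) q).trans (hl.id_le _))).trans (hq.trans ?_)
      exact (hn B).trans (hW B (le_max_left _ _))
    rw [Set.sdiff_eq_empty.2 hsub, measureReal_empty] at hpos
    exact lt_irrefl _ hpos
  · have hlt : Nat.pair n x < (S (Nat.pair n x + 1)).k :=
      (Nat.lt_succ_self _).trans_le (hk.id_le _)
    rw [hB _ _ hlt] at h
    obtain ⟨t, ht⟩ := hX _ _ h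
    obtain ⟨rfl, rfl⟩ := Nat.pair_eq_pair.1 ht
    rfl
  · rintro rfl
    rw [hB (n + 1) _ (hS n).code_lt]
    rw [(hS n).X_eq, Function.update_self]
  · intro n i hi
    obtain ⟨h1, h2⟩ := Finset.mem_Ico.1 hi
    rw [hA (n + 1) i (h2.trans_le (hS n).block_le)]
    exact (hS n).zeros i h1 h2

end SchnorrRel

theorem proposition6p6 :
    (∀ A B : SchnorrRel.Cantor,
      SchnorrRel.TTTestSchnorrRandomRelativeTo A B ↔ SchnorrRel.SchnorrRandomRelativeTo A B) ∧
    (∃ A B : SchnorrRel.Cantor,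
      SchnorrRel.SchnorrRandomUniformlyRelativeTo A B ∧
        ¬ SchnorrRel.TTTestSchnorrRandomRelativeTo A B) :=
  ⟨SchnorrRel.ttTest_iff_schnorr, SchnorrRel.exists_uniform_not_ttTest⟩
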